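/- **Conventions.** For elements $a,b$ of a preorder write $a\simeq b$ if $a\le b$ and $b\le a$. Let $\mathcal C$ be a category with finite products. An *indexed preorder* $\mathbf P$ with base $\mathcal C$ is a pseudofunctor from $\mathcal C^{op}$ to preorders: it assigns to each object $X$ a preorder $\mathbf P(X)$ and to each morphism $f:X\to Y$ a monotone map $f^*:\mathbf P(Y)\to\mathbf P(X)$ with $\mathrm{id}^*\simeq\mathrm{id}$ and $(g f)^*\simeq f^*g^*$. It is a *coherent hyperdoctrine* if * the poset reflection of each $\mathbf P(X)$ is a bounded distributive lattice and each $f^*$ induces a homomorphism of bounded lattices; * for every projection $\pi:X\times Y\to X$ the map $\pi^*$ has a left adjoint $\exists_\pi$, these satisfy the Frobenius condition $\exists_\pi(\pi^*\alpha\wedge\beta)\simeq\alpha\wedge\exists_\pi\beta$, and the Beck–Chevalley condition: $\exists_\pi f^*\simeq g^*\exists_{\pi'}$ for every pullback square $\pi' f=g\pi$ in which $\pi,\pi'$ are projections; * there are equality predicates: for every $X$ there is $\mathrm{Eq}_X\in\mathbf P(X\times X)$ such that, for all $A\in\mathbf P(X\times X)$, $\top\le\delta^*A\iff \mathrm{Eq}_X\le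 A$ (with $\delta$ the diagonal), and $\mathrm{Eq}_{A\times B}\simeq\pi_{13}^*\mathrm{Eq}_A\wedge\pi_{24}^*\mathrm{Eq}_B$. Let $\mathbf P$ be a coherent hyperdoctrine; sequents below are read in its internal logic. The category $\mathrm{PER}(\mathbf P)$ has as objects pairs $(X,\sim)$ with $X\in\mathcal C$ and ${\sim}\in\mathbf P(X\times X)$ symmetric and transitive. Morphisms $(X,\sim)\to(Y,\sim)$ are equivalence classes $[F]$ of functional relations, i.e. of $F\in\mathbf P(X\times Y)$ with $$F(x,y)\vdash x\sim x\wedge y\sim y,\qquad F(x,y)\wedge x\sim x'\wedge y\sim y'\vdash F(x',y'),$$ $$F(x,y)\wedge F(x,y')\vdash y\sim y',\qquad x\sim x\vdash\exists y\,F(x,y),$$ where $F$ and $G$ are equivalent if $F(x,y)\vdash G(x,y)$. The identity is $[\sim]$, and $[F]$ followed by $[G]$ is $[\exists y\,(F(x,y)\wedge G(y,z))]$. The indexed preorder $\mathrm{Strict}(\mathbf P)$ has base $\mathrm{PER}(\mathbf P)$. Its predicates on $(X,\sim)$ are the *strict relations*, i.e. the $\phi\in\mathbf P(X)$ with $\phi(x)\vdash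 x\sim x$ and $\phi(x)\wedge x\sim x'\vdash\phi(x')$, preordered as in $\mathbf P(X)$; reindexing along $[F]$ sends $\phi$ to $\exists y\,(F(x,y)\wedge\phi(y))$. A *coherent category* is a regular category in which finite unions of subobjects (including the empty one) exist and are stable under pullback. An *isomorphism* of indexed preorders with the same base consists of pseudonatural families of monotone maps in both directions, mutually inverse up to $\simeq$. **Theorem.** Let $\mathbf P$ be a coherent hyperdoctrine. Then $\mathrm{PER}(\mathbf P)$ has finite limits, and: 1. $\mathrm{Strict}(\mathbf P)$ is a coherent hyperdoctrine; 2. the indexed preorder $\mathrm{Sub}$ of subobjects of $\mathrm{PER}(\mathbf P)$, with reindexing given by pullback, is a coherent hyperdoctrine; 3. $\mathrm{Sub}$ is isomorphic to $\mathrm{Strict}(\mathbf P)$ over the identity of $\mathrm{PER}(\mathbf P)$; 4. $\mathrm{PER}(\mathbf P)$ is a coherent category. -/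

import Mathlib

open CategoryTheory CategoryTheory.Limits

universe u v w w'

namespace Hyperdoctrine

attribute [local simp] prod.lift_fst prod.lift_snd prod.lift_fst_assoc prod.lift_snd_assoc

/-! ### Preorders whose poset reflection is a distributive lattice -/

/-- Isomorphism of elements of a preorder. -/
abbrev PreIso {A : Type w} [Preorder A] (a b : A) : Prop := a ≤ b ∧ b ≤ a

infix:50 " ≃ₚ " => PreIso

/-- The poset reflection of `A` is a (bounded) distributive lattice. Tops, bottoms, meets and joins
are determined up to isomorphism only. -/
class IsDistPrelattice (A : Type w) [Preorder A] : Prop where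
  exists_top : ∃ t : A, IsTop t
  exists_bot : ∃ b : A, IsBot b
  exists_meet : ∀ a b : A, ∃ m : A, IsGLB {a, b} m
  exists_join : ∀ a b : A, ∃ j : A, IsLUB {a, b} j
  distrib : ∀ {a b c s m p q : A}, IsLUB {b, c} s → IsGLB {a, s} m →
    IsGLB {a, b} p → IsGLB {a, c} q → IsLUB {p, q} m

section Prelattice

variable {A : Type w} [Preorder A] [IsDistPrelattice A]

variable (A) in
/-- A chosen top element. -/
noncomputable def top : A := (IsDistPrelattice.exists_top (A := A)).choose

/-- A chosen meet. -/
noncomputable def meet (a b : A) : A := (IsDistPrelattice.exists_meet a b).choose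

infixl:70 " ⩓ " => meet

theorem meet_isGLB (a b : A) : IsGLB {a, b} (a ⩓ b) :=
  (IsDistPrelattice.exists_meet a b).choose_spec

theorem le_meet_iff {a b c : A} : c ≤ a ⩓ b ↔ c ≤ a ∧ c ≤ b := by
  rw [le_isGLB_iff (meet_isGLB a b)]
  simp [lowerBounds]

end Prelattice

/-- An order preserving map whose poset reflection is a homomorphism of (bounded) lattices. -/
structure IsLatticeMap {A : Type w} {B : Type w'} [Preorder A] [Preorder B] (f : A → B) :
    Prop where
  monotone : Monotone f
  map_top : ∀ {t : A}, IsTop t → IsTop (f t)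
  map_bot : ∀ {b : A}, IsBot b → IsBot (f b)
  map_meet : ∀ {a b m : A}, IsGLB {a, b} m → IsGLB {f a, f b} (f m)
  map_join : ∀ {a b j : A}, IsLUB {a, b} j → IsLUB {f a, f b} (f j)

/-! ### Indexed preorders and coherent hyperdoctrines -/

/-- A pseudofunctor from `Cᵒᵖ` to preorders; there are no coherence conditions on the
isomorphisms in `map_id` and `map_comp`, since any two parallel ones agree. -/
structure IndexedPreorder (C : Type u) [Category.{v} C] where
  Pred : C → Type w
  [preorder : ∀ X, Preorder (Pred X)]
  map : ∀ {X Y : C}, (X ⟶ Y) → Pred Y → Pred X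
  map_mono : ∀ {X Y : C} (f : X ⟶ Y), Monotone (map f)
  map_id : ∀ {X : C} (a : Pred X), map (𝟙 X) a ≃ₚ a
  map_comp : ∀ {X Y Z : C} (f : X ⟶ Y) (g : Y ⟶ Z) (a : Pred Z),
    map (f ≫ g) a ≃ₚ map f (map g a)

attribute [instance] IndexedPreorder.preorder

namespace IndexedPreorder

variable {C : Type u} [Category.{v} C]

/-- An isomorphism, over the identity of the base, between two indexed preorders: mutually inverse
pseudonatural transformations. All structure on the fibres that is given by universal properties
(lattice operations, adjoints, equality predicates) is automatically preserved. -/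
structure Iso (P : IndexedPreorder.{u, v, w} C) (Q : IndexedPreorder.{u, v, w'} C) where
  hom : ∀ X, P.Pred X → Q.Pred X
  inv : ∀ X, Q.Pred X → P.Pred X
  hom_mono : ∀ X, Monotone (hom X)
  inv_mono : ∀ X, Monotone (inv X)
  hom_inv : ∀ X (a : P.Pred X), inv X (hom X a) ≃ₚ a
  inv_hom : ∀ X (b : Q.Pred X), hom X (inv X b) ≃ₚ b
  hom_natural : ∀ {X Y : C} (f : X ⟶ Y) (a : P.Pred Y), hom X (P.map f a) ≃ₚ Q.map f (hom Y a)
  inv_natural : ∀ {X Y : C} (f : X ⟶ Y) (b : Q.Pred Y), inv X (Q.map f b) ≃ₚ P.map f (inv Y b)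

/-- The indexed preorder takes values in distributive prelattices and their homomorphisms. -/
class IsLatticeValued (P : IndexedPreorder.{u, v, w} C) : Prop where
  isDistPrelattice : ∀ X, IsDistPrelattice (P.Pred X)
  isLatticeMap : ∀ {X Y : C} (f : X ⟶ Y), IsLatticeMap (P.map f)

instance (P : IndexedPreorder.{u, v, w} C) [P.IsLatticeValued] (X : C) :
    IsDistPrelattice (P.Pred X) :=
  IsLatticeValued.isDistPrelattice X

variable [HasFiniteProducts C]

/-- Reindexing along product projections has left adjoints. -/
class HasLeftAdjoints (P : IndexedPreorder.{u, v, w} C) : Prop where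
  exists_left_adjoint : ∀ X Y : C, ∃ E : P.Pred (X ⨯ Y) → P.Pred X,
    GaloisConnection E (P.map (prod.fst : X ⨯ Y ⟶ X))

/-- The left adjoint to reindexing along `X ⨯ Y ⟶ X`. -/
noncomputable def ex (P : IndexedPreorder.{u, v, w} C) [P.HasLeftAdjoints] {X Y : C} :
    P.Pred (X ⨯ Y) → P.Pred X :=
  (HasLeftAdjoints.exists_left_adjoint X Y).choose

theorem ex_gc (P : IndexedPreorder.{u, v, w} C) [P.HasLeftAdjoints] (X Y : C) :
    GaloisConnection (P.ex (X := X) (Y := Y)) (P.map (prod.fst : X ⨯ Y ⟶ X)) :=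
  (HasLeftAdjoints.exists_left_adjoint X Y).choose_spec

/-- For any pullback square with top edge `prod.fst : B ⨯ Y ⟶ B`, bottom edge
`prod.fst : D ⨯ Z ⟶ D` and vertical edges `f`, `g`, one has `∃ f^* ≃ g^* ∃`. -/
def BeckChevalley (P : IndexedPreorder.{u, v, w} C) [P.HasLeftAdjoints] : Prop :=
  ∀ {B D Y Z : C} (f : B ⨯ Y ⟶ D ⨯ Z) (g : B ⟶ D),
    IsPullback f (prod.fst : B ⨯ Y ⟶ B) (prod.fst : D ⨯ Z ⟶ D) g →
    ∀ a : P.Pred (D ⨯ Z), P.ex (P.map f a) ≃ₚ P.map g (P.ex a)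

def Frobenius (P : IndexedPreorder.{u, v, w} C) [P.IsLatticeValued] [P.HasLeftAdjoints] : Prop :=
  ∀ {A B : C} (α : P.Pred A) (β : P.Pred (A ⨯ B)),
    P.ex (P.map prod.fst α ⩓ β) ≃ₚ α ⩓ P.ex β

/-- `E` is an equality predicate on `X`. -/
def IsEq (P : IndexedPreorder.{u, v, w} C) [P.IsLatticeValued] (X : C) (E : P.Pred (X ⨯ X)) :
    Prop :=
  ∀ A : P.Pred (X ⨯ X),
    top (P.Pred X) ≤ P.map (prod.lift (𝟙 X) (𝟙 X)) A ↔ E ≤ A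

/-- Equality predicates exist and the one on a product is computed componentwise: in the second
clause the two maps out of `(A ⨯ B) ⨯ (A ⨯ B)` are the projections `π₁₃` and `π₂₄`. -/
structure HasEquality (P : IndexedPreorder.{u, v, w} C) [P.IsLatticeValued] : Prop where
  exists_eq : ∀ X : C, ∃ E, P.IsEq X E
  eq_prod : ∀ {A B : C} {EA : P.Pred (A ⨯ A)} {EB : P.Pred (B ⨯ B)}
    {EAB : P.Pred ((A ⨯ B) ⨯ (A ⨯ B))}, P.IsEq A EA → P.IsEq B EB → P.IsEq (A ⨯ B) EAB →
    P.map (prod.lift (prod.fst ≫ prod.fst) (prod.snd ≫ prod.fst)) EA ⩓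
      P.map (prod.lift (prod.fst ≫ prod.snd) (prod.snd ≫ prod.snd)) EB ≃ₚ EAB

/-- The indexed preorder `P` is a coherent hyperdoctrine. -/
class IsCoherent (P : IndexedPreorder.{u, v, w} C) : Prop extends
    P.IsLatticeValued, P.HasLeftAdjoints where
  hasEquality : P.HasEquality
  frobenius : P.Frobenius
  beckChevalley : P.BeckChevalley

/-- The interpretation `R(x, y)` of a binary predicate at terms `x`, `y` in context `Γ`. -/
noncomputable def app (P : IndexedPreorder.{u, v, w} C) {Γ X Y : C} (R : P.Pred (X ⨯ Y))
    (x : Γ ⟶ X) (y : Γ ⟶ Y) : P.Pred Γ :=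
  P.map (prod.lift x y) R

/-! Rules of inference: `δ ≤ φ` in `P.Pred Γ` is read as `δ ⊢ φ` in context `Γ`. -/

section Rules

variable (P : IndexedPreorder.{u, v, w} C) {Γ Δ X Y Z : C}

set_option linter.unusedSectionVars false in
theorem le_map_comp_iff (σ : Γ ⟶ X) (s : X ⟶ Y) {φ : P.Pred Y} {δ : P.Pred Γ} :
    δ ≤ P.map (σ ≫ s) φ ↔ δ ≤ P.map σ (P.map s φ) :=
  ⟨fun h => h.trans (P.map_comp σ s φ).1, fun h => h.trans (P.map_comp σ s φ).2⟩

set_option linter.unusedSectionVars false in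
theorem map_tr {σ : Δ ⟶ Γ} {s : Γ ⟶ X} {φ : P.Pred X} {δ : P.Pred Γ} {δ' : P.Pred Δ}
    (hδ : δ' ≤ P.map σ δ) (h : δ ≤ P.map s φ) : δ' ≤ P.map (σ ≫ s) φ :=
  (P.le_map_comp_iff σ s).2 (hδ.trans (P.map_mono σ h))

theorem le_map_app_iff (σ : Δ ⟶ Γ) (x : Γ ⟶ X) (y : Γ ⟶ Y) {R : P.Pred (X ⨯ Y)} {δ : P.Pred Δ} :
    δ ≤ P.map σ (P.app R x y) ↔ δ ≤ P.app R (σ ≫ x) (σ ≫ y) := by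
  unfold app
  rw [← P.le_map_comp_iff, prod.comp_lift]

theorem app_tr {σ : Δ ⟶ Γ} {x : Γ ⟶ X} {y : Γ ⟶ Y} {R : P.Pred (X ⨯ Y)} {δ : P.Pred Γ}
    {δ' : P.Pred Δ} (hδ : δ' ≤ P.map σ δ) (h : δ ≤ P.app R x y) :
    δ' ≤ P.app R (σ ≫ x) (σ ≫ y) :=
  (P.le_map_app_iff σ x y).1 (hδ.trans (P.map_mono σ h))

theorem app_fst_snd (R : P.Pred (X ⨯ Y)) : P.app R prod.fst prod.snd ≃ₚ R := by
  unfold app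
  rw [prod.lift_fst_snd]
  exact P.map_id R

/-- To compare binary predicates it suffices to compare them at all terms. -/
theorem le_of_app {R S : P.Pred (X ⨯ Y)}
    (h : P.app R prod.fst prod.snd ≤ P.app S prod.fst prod.snd) : R ≤ S :=
  (P.app_fst_snd R).2.trans (h.trans (P.app_fst_snd S).1)

theorem app_mono {R S : P.Pred (X ⨯ Y)} (h : R ≤ S) (x : Γ ⟶ X) (y : Γ ⟶ Y) :
    P.app R x y ≤ P.app S x y :=
  P.map_mono _ h

variable [P.IsCoherent]

theorem le_map_meet_iff (σ : Γ ⟶ X) {a b : P.Pred X} {δ : P.Pred Γ} :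
    δ ≤ P.map σ (a ⩓ b) ↔ δ ≤ P.map σ a ∧ δ ≤ P.map σ b := by
  rw [le_isGLB_iff ((IsLatticeValued.isLatticeMap σ).map_meet (meet_isGLB a b))]
  simp [lowerBounds]

theorem ex_intro {x : Γ ⟶ X} (y : Γ ⟶ Y) {φ : P.Pred (X ⨯ Y)} {δ : P.Pred Γ}
    (h : δ ≤ P.map (prod.lift x y) φ) : δ ≤ P.map x (P.ex φ) := by
  have h1 := h.trans (P.map_mono (prod.lift x y) ((P.ex_gc X Y).le_u_l φ))
  rw [← P.le_map_comp_iff, prod.lift_fst] at h1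
  exact h1

theorem ex_elim {x : Γ ⟶ X} {φ : P.Pred (X ⨯ Y)} {δ ψ : P.Pred Γ} (h : δ ≤ P.map x (P.ex φ))
    (h' : ∀ (Δ : C) (σ : Δ ⟶ Γ) (y : Δ ⟶ Y) (δ' : P.Pred Δ), δ' ≤ P.map σ δ →
      δ' ≤ P.map (prod.lift (σ ≫ x) y) φ → δ' ≤ P.map σ ψ) : δ ≤ ψ := by
  have hx := (IsCoherent.beckChevalley (P := P) (prod.map x (𝟙 Y)) x
    (IsPullback.of_prod_fst_with_id x Y).flip φ).2
  have h1 := (le_meet_iff.2 ⟨le_refl δ, h.trans hx⟩).trans (IsCoherent.frobenius (P := P) δ _).2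
  refine h1.trans (((P.ex_gc _ _) _ _).2 ?_)
  refine h' _ prod.fst prod.snd _ (le_meet_iff.1 le_rfl).1 ?_
  have e : prod.lift (prod.fst ≫ x) prod.snd = prod.map x (𝟙 Y) := by
    ext <;> simp
  rw [e]
  exact (le_meet_iff.1 le_rfl).2

end Rules

end IndexedPreorder

open IndexedPreorder

/-! ### Partial equivalence relations -/

section PER

variable {C : Type u} [Category.{v} C] [HasFiniteProducts C]

/-- A partial equivalence relation over `P`. -/
structure PER (P : IndexedPreorder.{u, v, w} C) [P.IsCoherent] where
  carrier : C
  rel : P.Pred (carrier ⨯ carrier)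
  /-- `x ∼ y ⊢ y ∼ x` in the context `x, y` -/
  symm : P.app rel prod.fst prod.snd ≤ P.app rel prod.snd prod.fst
  /-- `x ∼ y ∧ y ∼ z ⊢ x ∼ z` in the context `(x, y), z` -/
  trans : P.app rel (prod.fst ≫ prod.fst : (carrier ⨯ carrier) ⨯ carrier ⟶ carrier)
        (prod.fst ≫ prod.snd) ⩓
      P.app rel (prod.fst ≫ prod.snd) prod.snd ≤
    P.app rel (prod.fst ≫ prod.fst) prod.snd

variable {P : IndexedPreorder.{u, v, w} C} [P.IsCoherent]

/-- Functional relations from `X` to `Y`. -/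
structure IsFunctional (X Y : PER P) (F : P.Pred (X.carrier ⨯ Y.carrier)) : Prop where
  /-- `F(x, y) ⊢ x ∼ x ∧ y ∼ y` in the context `x, y` -/
  strict : P.app F prod.fst prod.snd ≤
    P.app X.rel prod.fst prod.fst ⩓ P.app Y.rel prod.snd prod.snd
  /-- `F(x, y) ∧ x ∼ x' ∧ y ∼ y' ⊢ F(x', y')` in the context `(x, x'), (y, y')` -/
  relational :
    P.app F (prod.fst ≫ prod.fst :
          (X.carrier ⨯ X.carrier) ⨯ (Y.carrier ⨯ Y.carrier) ⟶ X.carrier)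
        (prod.snd ≫ prod.fst) ⩓
      P.app X.rel (prod.fst ≫ prod.fst) (prod.fst ≫ prod.snd) ⩓
      P.app Y.rel (prod.snd ≫ prod.fst) (prod.snd ≫ prod.snd) ≤
    P.app F (prod.fst ≫ prod.snd) (prod.snd ≫ prod.snd)
  /-- `F(x, y) ∧ F(x, y') ⊢ y ∼ y'` in the context `(x, y), y'` -/
  singleValued :
    P.app F (prod.fst ≫ prod.fst : (X.carrier ⨯ Y.carrier) ⨯ Y.carrier ⟶ X.carrier)
        (prod.fst ≫ prod.snd) ⩓
      P.app F (prod.fst ≫ prod.fst) prod.snd ≤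
    P.app Y.rel (prod.fst ≫ prod.snd) prod.snd
  /-- `x ∼ x ⊢ ∃ y, F(x, y)` in the context `x` -/
  total : P.app X.rel (𝟙 X.carrier) (𝟙 X.carrier) ≤ P.ex F

/-! The same conditions at arbitrary terms. -/

section Terms

variable {Γ : C} {δ : P.Pred Γ} {X Y Z : PER P}

theorem PER.symm_app {a b : Γ ⟶ X.carrier} (h : δ ≤ P.app X.rel a b) : δ ≤ P.app X.rel b a := by
  have h1 := P.map_mono (prod.lift a b) X.symm
  have h2 : δ ≤ P.map (prod.lift a b) (P.app X.rel prod.fst prod.snd) := by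
    rw [P.le_map_app_iff]; simpa using h
  simpa [P.le_map_app_iff] using h2.trans h1

theorem PER.trans_app {a b c : Γ ⟶ X.carrier} (h : δ ≤ P.app X.rel a b)
    (h' : δ ≤ P.app X.rel b c) : δ ≤ P.app X.rel a c := by
  have h1 := P.map_mono (prod.lift (prod.lift a b) c) X.trans
  have h2 := (le_map_meet_iff P (prod.lift (prod.lift a b) c) (δ := δ)
    (a := P.app X.rel (prod.fst ≫ prod.fst) (prod.fst ≫ prod.snd))
    (b := P.app X.rel (prod.fst ≫ prod.snd) prod.snd)).2
    ⟨by rw [P.le_map_app_iff]; simpa using h, by rw [P.le_map_app_iff]; simpa using h'⟩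
  simpa [P.le_map_app_iff] using h2.trans h1

theorem IsFunctional.strict_left {F : P.Pred (X.carrier ⨯ Y.carrier)} (hF : IsFunctional X Y F)
    {x : Γ ⟶ X.carrier} {y : Γ ⟶ Y.carrier} (h : δ ≤ P.app F x y) : δ ≤ P.app X.rel x x := by
  have h2 : δ ≤ P.map (prod.lift x y) (P.app F prod.fst prod.snd) := by
    rw [P.le_map_app_iff]; simpa using h
  have h1 := ((P.le_map_meet_iff _).1 (h2.trans (P.map_mono _ hF.strict))).1
  simpa [P.le_map_app_iff] using h1

theorem IsFunctional.strict_right {F : P.Pred (X.carrier ⨯ Y.carrier)} (hF : IsFunctional X Y F)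
    {x : Γ ⟶ X.carrier} {y : Γ ⟶ Y.carrier} (h : δ ≤ P.app F x y) : δ ≤ P.app Y.rel y y := by
  have h2 : δ ≤ P.map (prod.lift x y) (P.app F prod.fst prod.snd) := by
    rw [P.le_map_app_iff]; simpa using h
  have h1 := ((P.le_map_meet_iff _).1 (h2.trans (P.map_mono _ hF.strict))).2
  simpa [P.le_map_app_iff] using h1

theorem IsFunctional.relational_app {F : P.Pred (X.carrier ⨯ Y.carrier)}
    (hF : IsFunctional X Y F) {x x' : Γ ⟶ X.carrier} {y y' : Γ ⟶ Y.carrier}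
    (h : δ ≤ P.app F x y) (hx : δ ≤ P.app X.rel x x') (hy : δ ≤ P.app Y.rel y y') :
    δ ≤ P.app F x' y' := by
  have h1 := P.map_mono (prod.lift (prod.lift x x') (prod.lift y y')) hF.relational
  have h2 : δ ≤ _ := le_trans (by
    simp only [P.le_map_meet_iff, P.le_map_app_iff]
    refine ⟨⟨?_, ?_⟩, ?_⟩ <;> simpa) h1
  simpa [P.le_map_app_iff] using h2

theorem IsFunctional.singleValued_app {F : P.Pred (X.carrier ⨯ Y.carrier)}
    (hF : IsFunctional X Y F) {x : Γ ⟶ X.carrier} {y y' : Γ ⟶ Y.carrier}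
    (h : δ ≤ P.app F x y) (h' : δ ≤ P.app F x y') : δ ≤ P.app Y.rel y y' := by
  have h1 := P.map_mono (prod.lift (prod.lift x y) y') hF.singleValued
  have h2 : δ ≤ _ := le_trans (by
    simp only [P.le_map_meet_iff, P.le_map_app_iff]
    refine ⟨?_, ?_⟩ <;> simpa) h1
  simpa [P.le_map_app_iff] using h2

theorem IsFunctional.total_app {F : P.Pred (X.carrier ⨯ Y.carrier)}
    (hF : IsFunctional X Y F) {x : Γ ⟶ X.carrier} (h : δ ≤ P.app X.rel x x) :
    δ ≤ P.map x (P.ex F) := by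
  refine le_trans ?_ (P.map_mono x hF.total)
  rw [P.le_map_app_iff]; simpa

/-- Eliminating `x ∼ x` into `∃ y, F(x, y)`. -/
theorem IsFunctional.total_elim {F : P.Pred (X.carrier ⨯ Y.carrier)}
    (hF : IsFunctional X Y F) {x : Γ ⟶ X.carrier} {ψ : P.Pred Γ} (h : δ ≤ P.app X.rel x x)
    (h' : ∀ (Δ : C) (σ : Δ ⟶ Γ) (y : Δ ⟶ Y.carrier) (δ' : P.Pred Δ), δ' ≤ P.map σ δ →
      δ' ≤ P.app F (σ ≫ x) y → δ' ≤ P.map σ ψ) : δ ≤ ψ :=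
  P.ex_elim (hF.total_app h) h'

/-- The sequent `F(x, y) ⊢ G(x, y)` between functional relations is symmetric in `F`, `G`. -/
theorem IsFunctional.le_symm {F G : P.Pred (X.carrier ⨯ Y.carrier)} (hF : IsFunctional X Y F)
    (hG : IsFunctional X Y G) (h : F ≤ G) : G ≤ F := by
  refine P.le_of_app ?_
  refine hF.total_elim (hG.strict_left le_rfl) fun Δ σ y δ' hδ hy => ?_
  rw [P.le_map_app_iff]
  have h1 := P.app_tr hδ le_rfl
  exact hF.relational_app hy (hG.strict_left h1)
    (hG.singleValued_app (hy.trans (P.app_mono h _ _)) h1)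

theorem PER.isFunctional_rel (X : PER P) : IsFunctional X X X.rel where
  strict := le_meet_iff.2 ⟨X.trans_app le_rfl (X.symm_app le_rfl),
    X.trans_app (X.symm_app le_rfl) le_rfl⟩
  relational := by
    have h := le_meet_iff.1 (le_refl (P.app X.rel (prod.fst ≫ prod.fst :
          (X.carrier ⨯ X.carrier) ⨯ (X.carrier ⨯ X.carrier) ⟶ X.carrier)
        (prod.snd ≫ prod.fst) ⩓
      P.app X.rel (prod.fst ≫ prod.fst) (prod.fst ≫ prod.snd) ⩓
      P.app X.rel (prod.snd ≫ prod.fst) (prod.snd ≫ prod.snd)))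
    have h' := le_meet_iff.1 h.1
    exact X.trans_app (X.symm_app h'.2) (X.trans_app h'.1 h.2)
  singleValued := X.trans_app (X.symm_app (le_meet_iff.1 le_rfl).1) (le_meet_iff.1 le_rfl).2
  total := by
    refine (P.ex_intro (x := 𝟙 _) (𝟙 _) (le_refl _)).trans (P.map_id _).1

end Terms

/-- The relation `∃ y, F(x, y) ∧ G(y, z)`, where `∃` is taken from the context `(x, z), y`. -/
noncomputable def compRel {X Y Z : C} (F : P.Pred (X ⨯ Y)) (G : P.Pred (Y ⨯ Z)) :
    P.Pred (X ⨯ Z) :=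
  P.ex (P.app F (prod.fst ≫ prod.fst : (X ⨯ Z) ⨯ Y ⟶ X) prod.snd ⩓
    P.app G prod.snd (prod.fst ≫ prod.snd))

theorem compRel_intro {Γ X Y Z : C} {F : P.Pred (X ⨯ Y)} {G : P.Pred (Y ⨯ Z)} {δ : P.Pred Γ}
    {x : Γ ⟶ X} (y : Γ ⟶ Y) {z : Γ ⟶ Z} (h : δ ≤ P.app F x y) (h' : δ ≤ P.app G y z) :
    δ ≤ P.app (compRel F G) x z := by
  refine P.ex_intro y ?_
  simp only [P.le_map_meet_iff, P.le_map_app_iff]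
  refine ⟨?_, ?_⟩ <;> simpa

theorem compRel_elim {Γ X Y Z : C} {F : P.Pred (X ⨯ Y)} {G : P.Pred (Y ⨯ Z)} {δ ψ : P.Pred Γ}
    {x : Γ ⟶ X} {z : Γ ⟶ Z} (h : δ ≤ P.app (compRel F G) x z)
    (h' : ∀ (Δ : C) (σ : Δ ⟶ Γ) (y : Δ ⟶ Y) (δ' : P.Pred Δ), δ' ≤ P.map σ δ →
      δ' ≤ P.app F (σ ≫ x) y → δ' ≤ P.app G y (σ ≫ z) → δ' ≤ P.map σ ψ) : δ ≤ ψ := by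
  refine P.ex_elim h fun Δ σ y δ' hδ hy => ?_
  simp only [P.le_map_meet_iff, P.le_map_app_iff] at hy
  refine h' Δ σ y δ' hδ ?_ ?_
  · simpa using hy.1
  · simpa using hy.2

theorem compRel_mono {X Y Z : C} {F F' : P.Pred (X ⨯ Y)} {G G' : P.Pred (Y ⨯ Z)} (h : F ≤ F')
    (h' : G ≤ G') : compRel F G ≤ compRel F' G' := by
  refine P.le_of_app (compRel_elim le_rfl fun Δ σ y δ' _ h1 h2 => ?_)
  rw [P.le_map_app_iff]
  exact compRel_intro y (h1.trans (P.app_mono h _ _)) (h2.trans (P.app_mono h' _ _))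

theorem IsFunctional.comp {X Y Z : PER P} {F : P.Pred (X.carrier ⨯ Y.carrier)}
    {G : P.Pred (Y.carrier ⨯ Z.carrier)} (hF : IsFunctional X Y F) (hG : IsFunctional Y Z G) :
    IsFunctional X Z (compRel F G) where
  strict := by
    refine le_meet_iff.2 ⟨compRel_elim le_rfl fun Δ σ y δ' _ h1 h2 => ?_,
      compRel_elim le_rfl fun Δ σ y δ' _ h1 h2 => ?_⟩ <;> rw [P.le_map_app_iff]
    · exact hF.strict_left h1
    · exact hG.strict_right h2
  relational := by
    have h := le_meet_iff.1 (le_refl (P.app (compRel F G) (prod.fst ≫ prod.fst :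
          (X.carrier ⨯ X.carrier) ⨯ (Z.carrier ⨯ Z.carrier) ⟶ X.carrier)
        (prod.snd ≫ prod.fst) ⩓
      P.app X.rel (prod.fst ≫ prod.fst) (prod.fst ≫ prod.snd) ⩓
      P.app Z.rel (prod.snd ≫ prod.fst) (prod.snd ≫ prod.snd)))
    have h' := le_meet_iff.1 h.1
    refine compRel_elim h'.1 fun Δ σ y δ' hδ h1 h2 => ?_
    rw [P.le_map_app_iff]
    exact compRel_intro y (hF.relational_app h1 (P.app_tr hδ h'.2) (hF.strict_right h1))
      (hG.relational_app h2 (hG.strict_left h2) (P.app_tr hδ h.2))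
  singleValued := by
    have h := le_meet_iff.1 (le_refl (
      P.app (compRel F G) (prod.fst ≫ prod.fst :
          (X.carrier ⨯ Z.carrier) ⨯ Z.carrier ⟶ X.carrier) (prod.fst ≫ prod.snd) ⩓
        P.app (compRel F G) (prod.fst ≫ prod.fst) prod.snd))
    refine compRel_elim h.1 fun Δ σ y δ' hδ h1 h2 => ?_
    refine compRel_elim (P.app_tr hδ h.2) fun Δ' τ y' δ'' hδ' h1' h2' => ?_
    rw [← P.le_map_comp_iff, P.le_map_app_iff]
    have h3 := hF.singleValued_app h1' (P.app_tr hδ' h1)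
    have h4 := hG.relational_app h2' h3 (hG.strict_right h2')
    have h5 := hG.singleValued_app (P.app_tr hδ' h2) h4
    simpa using h5
  total := by
    refine hF.total_elim le_rfl fun Δ σ y δ' hδ h1 => ?_
    refine hG.total_elim (hF.strict_right h1) fun Δ' τ z δ'' hδ' h2 => ?_
    rw [← P.le_map_comp_iff]
    refine P.ex_intro z (compRel_intro (τ ≫ y) ?_ h2)
    simpa using P.app_tr hδ' h1

/-- Functional relations, preordered by entailment, up to equivalence. -/
instance funRelSetoid (X Y : PER P) : Setoid {F : P.Pred (X.carrier ⨯ Y.carrier) //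
    IsFunctional X Y F} where
  r F G := F.1 ≤ G.1
  iseqv := ⟨fun _ => le_rfl, fun {F G} h => F.2.le_symm G.2 h, fun h h' => h.trans h'⟩

/-- The category `PER(P)`: morphisms are equivalence classes of functional relations. -/
noncomputable instance : Category (PER P) where
  Hom X Y := Quotient (funRelSetoid X Y)
  id X := Quotient.mk _ ⟨X.rel, X.isFunctional_rel⟩
  comp := Quotient.map₂ (fun F G => ⟨compRel F.1 G.1, F.2.comp G.2⟩)
    (fun _ _ h _ _ h' => compRel_mono h h')
  id_comp := by
    rintro X Y ⟨F, hF⟩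
    refine Quotient.sound (P.le_of_app (compRel_elim le_rfl fun Δ σ y δ' _ h1 h2 => ?_))
    rw [P.le_map_app_iff]
    exact hF.relational_app h2 (X.symm_app h1) (hF.strict_right h2)
  comp_id := by
    rintro X Y ⟨F, hF⟩
    refine Quotient.sound (P.le_of_app (compRel_elim le_rfl fun Δ σ y δ' _ h1 h2 => ?_))
    rw [P.le_map_app_iff]
    exact hF.relational_app h1 (hF.strict_left h1) h2
  assoc := by
    rintro W X Y Z ⟨F, hF⟩ ⟨G, hG⟩ ⟨H, hH⟩
    refine Quotient.sound (P.le_of_app (compRel_elim le_rfl fun Δ σ y δ' _ h1 h2 => ?_))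
    refine compRel_elim h1 fun Δ' τ x δ'' hδ' h3 h4 => ?_
    rw [← P.le_map_comp_iff, P.le_map_app_iff]
    refine compRel_intro x (by simpa using h3) (compRel_intro (τ ≫ y) h4 ?_)
    simpa using P.app_tr hδ' h2

/-! ### Strict relations -/

/-- Strict relations on `X`. -/
structure IsStrictRel (X : PER P) (φ : P.Pred X.carrier) : Prop where
  /-- `φ(x) ⊢ x ∼ x` -/
  strict : φ ≤ P.app X.rel (𝟙 X.carrier) (𝟙 X.carrier)
  /-- `φ(x) ∧ x ∼ x' ⊢ φ(x')` in the context `x, x'` -/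
  relational : P.map (prod.fst : X.carrier ⨯ X.carrier ⟶ X.carrier) φ ⩓
      P.app X.rel prod.fst prod.snd ≤
    P.map prod.snd φ

theorem IsStrictRel.strict_app {Γ : C} {δ : P.Pred Γ} {X : PER P} {φ : P.Pred X.carrier}
    (hφ : IsStrictRel X φ) {x : Γ ⟶ X.carrier} (h : δ ≤ P.map x φ) : δ ≤ P.app X.rel x x := by
  have h1 := h.trans (P.map_mono x hφ.strict)
  simpa [P.le_map_app_iff] using h1

theorem IsStrictRel.relational_app {Γ : C} {δ : P.Pred Γ} {X : PER P} {φ : P.Pred X.carrier}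
    (hφ : IsStrictRel X φ) {x x' : Γ ⟶ X.carrier} (h : δ ≤ P.map x φ)
    (h' : δ ≤ P.app X.rel x x') : δ ≤ P.map x' φ := by
  have h1 := P.map_mono (prod.lift x x') hφ.relational
  have h2 : δ ≤ _ := le_trans (by
    rw [P.le_map_meet_iff, P.le_map_app_iff, ← P.le_map_comp_iff]
    refine ⟨?_, ?_⟩ <;> simpa) h1
  simpa [← P.le_map_comp_iff] using h2

/-- The predicate `∃ y, F(x, y) ∧ φ(y)`. -/
noncomputable def preimage {X Y : C} (F : P.Pred (X ⨯ Y)) (φ : P.Pred Y) : P.Pred X :=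
  P.ex (P.app F prod.fst prod.snd ⩓ P.map prod.snd φ)

theorem preimage_intro {Γ X Y : C} {F : P.Pred (X ⨯ Y)} {φ : P.Pred Y} {δ : P.Pred Γ}
    {x : Γ ⟶ X} (y : Γ ⟶ Y) (h : δ ≤ P.app F x y) (h' : δ ≤ P.map y φ) :
    δ ≤ P.map x (preimage F φ) := by
  refine P.ex_intro y ?_
  rw [P.le_map_meet_iff, P.le_map_app_iff, ← P.le_map_comp_iff]
  refine ⟨?_, ?_⟩ <;> simpa

theorem preimage_elim {Γ X Y : C} {F : P.Pred (X ⨯ Y)} {φ : P.Pred Y} {δ ψ : P.Pred Γ}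
    {x : Γ ⟶ X} (h : δ ≤ P.map x (preimage F φ))
    (h' : ∀ (Δ : C) (σ : Δ ⟶ Γ) (y : Δ ⟶ Y) (δ' : P.Pred Δ), δ' ≤ P.map σ δ →
      δ' ≤ P.app F (σ ≫ x) y → δ' ≤ P.map y φ → δ' ≤ P.map σ ψ) : δ ≤ ψ := by
  refine P.ex_elim h fun Δ σ y δ' hδ hy => ?_
  rw [P.le_map_meet_iff, P.le_map_app_iff, ← P.le_map_comp_iff] at hy
  refine h' Δ σ y δ' hδ ?_ ?_
  · simpa using hy.1
  · simpa using hy.2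

theorem preimage_mono {X Y : C} {F F' : P.Pred (X ⨯ Y)} {φ φ' : P.Pred Y} (h : F ≤ F')
    (h' : φ ≤ φ') : preimage F φ ≤ preimage F' φ' := by
  refine preimage_elim (P.map_id _).2 fun Δ σ y δ' _ h1 h2 => ?_
  exact preimage_intro y (by simpa using h1.trans (P.app_mono h _ _)) (h2.trans (P.map_mono _ h'))

theorem IsFunctional.isStrictRel_preimage {X Y : PER P} {F : P.Pred (X.carrier ⨯ Y.carrier)}
    (hF : IsFunctional X Y F) (φ : P.Pred Y.carrier) : IsStrictRel X (preimage F φ) where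
  strict := by
    refine preimage_elim (P.map_id _).2 fun Δ σ y δ' _ h1 h2 => ?_
    rw [P.le_map_app_iff]
    exact hF.strict_left h1
  relational := by
    have h := le_meet_iff.1 (le_refl (
      P.map (prod.fst : X.carrier ⨯ X.carrier ⟶ X.carrier) (preimage F φ) ⩓
        P.app X.rel prod.fst prod.snd))
    refine preimage_elim h.1 fun Δ σ y δ' hδ h1 h2 => ?_
    rw [← P.le_map_comp_iff]
    exact preimage_intro y
      (hF.relational_app h1 (P.app_tr hδ h.2) (hF.strict_right h1)) h2

variable (P) in
/-- The indexed preorder `Strict(P)` of strict relations. Reindexing along `f : X ⟶ Y` sends `φ` to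
`∃ y, F(x, y) ∧ φ(y)`, where `F` is a representative of `f`. -/
noncomputable def strictRelations : IndexedPreorder.{max u w, w, w} (PER P) where
  Pred X := {φ : P.Pred X.carrier // IsStrictRel X φ}
  map f φ := ⟨preimage (Quotient.out f).1 φ.1, (Quotient.out f).2.isStrictRel_preimage φ.1⟩
  map_mono f _ _ h := preimage_mono le_rfl h
  map_id := by
    rintro X ⟨φ, hφ⟩
    have h : (Quotient.out (𝟙 X)).1 ≤ X.rel :=
      Quotient.exact (Quotient.out_eq (𝟙 X))
    have h' : X.rel ≤ (Quotient.out (𝟙 X)).1 :=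
      (Quotient.out (𝟙 X)).2.le_symm X.isFunctional_rel h
    constructor
    · refine preimage_elim (P.map_id _).2 fun Δ σ y δ' _ h1 h2 => ?_
      refine hφ.relational_app h2 (X.symm_app ?_)
      simpa using h1.trans (P.app_mono h _ _)
    · change φ ≤ preimage _ _
      exact (preimage_intro (𝟙 _) (hφ.strict.trans (P.app_mono h' _ _)) (P.map_id _).2).trans
        (P.map_id _).1
  map_comp := by
    rintro X Y Z f g ⟨φ, hφ⟩
    have e : Quotient.mk (funRelSetoid X Z) (Quotient.out (f ≫ g)) =
        Quotient.mk (funRelSetoid X Z) ⟨compRel (Quotient.out f).1 (Quotient.out g).1,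
          (Quotient.out f).2.comp (Quotient.out g).2⟩ := by
      refine (Quotient.out_eq (f ≫ g)).trans ?_
      conv_lhs => rw [← Quotient.out_eq f, ← Quotient.out_eq g]
      rfl
    have h : (Quotient.out (f ≫ g)).1 ≤ compRel (Quotient.out f).1 (Quotient.out g).1 :=
      Quotient.exact e
    have h' : compRel (Quotient.out f).1 (Quotient.out g).1 ≤ (Quotient.out (f ≫ g)).1 :=
      Quotient.exact e.symm
    constructor
    · refine preimage_elim (P.map_id _).2 fun Δ σ z δ' _ h1 h2 => ?_
      refine compRel_elim (h1.trans (P.app_mono h _ _)) fun Δ' τ y δ'' hδ h3 h4 => ?_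
      rw [← P.le_map_comp_iff]
      exact preimage_intro y (by simpa using h3)
        (preimage_intro (τ ≫ z) h4 (P.map_tr hδ h2))
    · refine preimage_elim (P.map_id _).2 fun Δ σ y δ' _ h1 h2 => ?_
      refine preimage_elim h2 fun Δ' τ z δ'' hδ h3 h4 => ?_
      rw [← P.le_map_comp_iff]
      refine preimage_intro z (le_trans (compRel_intro (τ ≫ y) ?_ h3) (P.app_mono h' _ _)) h4
      simpa using P.app_tr hδ h1

end PER

/-! ### Subobjects and coherent categories -/

/-- The indexed preorder of subobjects; reindexing is pullback. -/
noncomputable def subobjects (D : Type u) [Category.{v} D] [HasPullbacks D] :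
    IndexedPreorder.{u, v, max u v} D where
  Pred X := Subobject X
  map f := (Subobject.pullback f).obj
  map_mono f := (Subobject.pullback f).monotone
  map_id a := ⟨(Subobject.pullback_id a).le, (Subobject.pullback_id a).ge⟩
  map_comp f g a := ⟨(Subobject.pullback_comp f g a).le, (Subobject.pullback_comp f g a).ge⟩

/-- A coherent category: a regular category in which finite unions of subobjects exist and are
stable under pullback. -/
class CoherentCategory (D : Type u) [Category.{v} D] : Prop extends Regular D where
  exists_bot : ∀ X : D, ∃ b : Subobject X, IsBot b
  exists_union : ∀ {X : D} (S T : Subobject X), ∃ U, IsLUB {S, T} U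
  pullback_bot : ∀ {X Y : D} (f : X ⟶ Y) {b : Subobject Y}, IsBot b →
    IsBot ((Subobject.pullback f).obj b)
  pullback_union : ∀ {X Y : D} (f : X ⟶ Y) {S T U : Subobject Y}, IsLUB {S, T} U →
    IsLUB {(Subobject.pullback f).obj S, (Subobject.pullback f).obj T}
      ((Subobject.pullback f).obj U)

end Hyperdoctrine

set_option linter.unusedSectionVars false

/-! The argument is reasoning with elements in the internal logic. A term `x : Γ ⟶ X` is a
generalized element of X, and `δ ≤ P.map x φ` says that φ(x) follows from δ. The rules `ex_intro`,
`ex_elim` and `join_elim` handle ∃ and ∨; Frobenius with Beck–Chevalley, respectively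
distributivity, are what permit a side context δ in the elimination rules. Eliminating ∃ passes to a
larger context, which is why the lemmas quantify over all Γ and δ. With these rules the objects of
PER(P) behave like sets with a partial equivalence relation, and finite limits are built as for
sets: products componentwise, equalizers by restricting ∼ to a strict relation (`restrict`, `incl`).

Two facts then carry most of the weight. Elements x, y with the same value in Z come from an element
of any pullback of the cospan (`isPullback_elim`). And f factors through a mono m as soon as `image
f ≤ image m` (`exists_factor_of_mono`), because monos are injective in the internal sense.

Strict relations inherit meets, joins and bottom from P. Since graphs are total and single-valued,
reindexing is a lattice map whose left adjoint, along every morphism, is the direct image;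
`isPullback_elim` yields Beck–Chevalley for every pullback square. A subobject corresponds to the
image of its arrow, a strict relation φ to the inclusion of X restricted to φ (`subobjectsIso`).
Each structure is proved on the side where it is easy and transported to the other: lattices and
quantifiers from Strict to Sub, equality from Sub, where it is the diagonal, to Strict.

For regularity, the internally surjective morphisms turn out to be the regular epimorphisms: they
are coequalizers of their kernel pairs, are stable under pullback, and form the first half of the
image factorization. Stable finite unions are the lattice structure of Sub. -/

namespace Hyperdoctrine

attribute [local simp] prod.lift_fst prod.lift_snd prod.lift_fst_assoc prod.lift_snd_assoc

open IndexedPreorder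

/-! ### Reasoning with generalized elements -/

section Calculus

variable {C : Type u} [Category.{v} C] [HasFiniteProducts C]
  {P : IndexedPreorder.{u, v, w} C} [P.IsCoherent]

/-! ### Rules for joins -/

/-- Case distinction under a join, with a side context. -/
theorem join_elim {A : Type w} [Preorder A] [IsDistPrelattice A] {a b j δ ψ : A}
    (hj : IsLUB {a, b} j) (h : δ ≤ j) (ha : ∀ δ' ≤ δ, δ' ≤ a → δ' ≤ ψ)
    (hb : ∀ δ' ≤ δ, δ' ≤ b → δ' ≤ ψ) : δ ≤ ψ := by
  -- Distributivity splits `δ ⩓ j` itself, so the context δ survives in both cases.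
  have h1 := IsDistPrelattice.distrib hj (meet_isGLB δ j) (meet_isGLB δ a) (meet_isGLB δ b)
  have h2 : δ ⩓ j ≤ ψ := h1.2 <| by
    rintro x (rfl | rfl)
    · exact ha _ (le_meet_iff.1 le_rfl).1 (le_meet_iff.1 le_rfl).2
    · exact hb _ (le_meet_iff.1 le_rfl).1 (le_meet_iff.1 le_rfl).2
  exact (le_meet_iff.2 ⟨le_rfl, h⟩).trans h2

theorem map_join_elim {Γ X : C} {a b j : P.Pred X} {δ ψ : P.Pred Γ} (x : Γ ⟶ X)
    (hj : IsLUB {a, b} j) (h : δ ≤ P.map x j) (ha : ∀ δ' ≤ δ, δ' ≤ P.map x a → δ' ≤ ψ)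
    (hb : ∀ δ' ≤ δ, δ' ≤ P.map x b → δ' ≤ ψ) : δ ≤ ψ :=
  join_elim ((IsLatticeValued.isLatticeMap x).map_join hj) h ha hb

/-! ### Converse relations -/

/-- The converse of a relation. -/
noncomputable def conv {X Y : C} (F : P.Pred (X ⨯ Y)) : P.Pred (Y ⨯ X) :=
  P.app F prod.snd prod.fst

theorem le_app_conv_iff {Γ X Y : C} {F : P.Pred (X ⨯ Y)} {δ : P.Pred Γ} {x : Γ ⟶ X} {y : Γ ⟶ Y} :
    δ ≤ P.app (conv F) y x ↔ δ ≤ P.app F x y := by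
  change δ ≤ P.map _ (P.app F prod.snd prod.fst) ↔ _
  rw [P.le_map_app_iff]
  simp

/-! ### Checking structure at arbitrary terms -/

/-- A sequent valid at all generalized elements is valid at the generic one: the identity term in
context φ. -/
theorem le_of_map {X : C} {φ ψ : P.Pred X}
    (h : ∀ {Γ : C} {δ : P.Pred Γ} {x : Γ ⟶ X}, δ ≤ P.map x φ → δ ≤ P.map x ψ) : φ ≤ ψ :=
  (h (P.map_id φ).2).trans (P.map_id ψ).1

theorem le_of_forall_app {X Y : C} {F G : P.Pred (X ⨯ Y)}
    (h : ∀ {Γ : C} {δ : P.Pred Γ} {x : Γ ⟶ X} {y : Γ ⟶ Y},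
      δ ≤ P.app F x y → δ ≤ P.app G x y) : F ≤ G :=
  P.le_of_app (h le_rfl)

/-- A partial equivalence relation from symmetry and transitivity at arbitrary terms. -/
def PER.ofApp {X : C} (R : P.Pred (X ⨯ X))
    (symm : ∀ {Γ : C} {δ : P.Pred Γ} {x y : Γ ⟶ X}, δ ≤ P.app R x y → δ ≤ P.app R y x)
    (trans : ∀ {Γ : C} {δ : P.Pred Γ} {x y z : Γ ⟶ X}, δ ≤ P.app R x y → δ ≤ P.app R y z →
      δ ≤ P.app R x z) : PER P where
  carrier := X
  rel := R
  symm := symm le_rfl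
  trans := trans (le_meet_iff.1 le_rfl).1 (le_meet_iff.1 le_rfl).2

theorem IsFunctional.of_app {X Y : PER P} {F : P.Pred (X.carrier ⨯ Y.carrier)}
    (strict : ∀ {Γ : C} {δ : P.Pred Γ} {x : Γ ⟶ X.carrier} {y : Γ ⟶ Y.carrier},
      δ ≤ P.app F x y → δ ≤ P.app X.rel x x ∧ δ ≤ P.app Y.rel y y)
    (relational : ∀ {Γ : C} {δ : P.Pred Γ} {x x' : Γ ⟶ X.carrier} {y y' : Γ ⟶ Y.carrier},
      δ ≤ P.app F x y → δ ≤ P.app X.rel x x' → δ ≤ P.app Y.rel y y' → δ ≤ P.app F x' y')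
    (singleValued : ∀ {Γ : C} {δ : P.Pred Γ} {x : Γ ⟶ X.carrier} {y y' : Γ ⟶ Y.carrier},
      δ ≤ P.app F x y → δ ≤ P.app F x y' → δ ≤ P.app Y.rel y y')
    (total : ∀ {Γ : C} {δ : P.Pred Γ} {x : Γ ⟶ X.carrier},
      δ ≤ P.app X.rel x x → δ ≤ P.map x (P.ex F)) : IsFunctional X Y F where
  strict := le_meet_iff.2 (strict le_rfl)
  relational := relational (le_meet_iff.1 (le_meet_iff.1 le_rfl).1).1
    (le_meet_iff.1 (le_meet_iff.1 le_rfl).1).2 (le_meet_iff.1 le_rfl).2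
  singleValued := singleValued (le_meet_iff.1 le_rfl).1 (le_meet_iff.1 le_rfl).2
  total := (total le_rfl).trans (P.map_id _).1

theorem IsStrictRel.of_map {X : PER P} {φ : P.Pred X.carrier}
    (strict : ∀ {Γ : C} {δ : P.Pred Γ} {x : Γ ⟶ X.carrier},
      δ ≤ P.map x φ → δ ≤ P.app X.rel x x)
    (relational : ∀ {Γ : C} {δ : P.Pred Γ} {x x' : Γ ⟶ X.carrier},
      δ ≤ P.map x φ → δ ≤ P.app X.rel x x' → δ ≤ P.map x' φ) : IsStrictRel X φ where
  strict := strict (P.map_id _).2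
  relational := relational (le_meet_iff.1 le_rfl).1 (le_meet_iff.1 le_rfl).2

/-! ### Graphs of morphisms -/

section Graph

variable {X Y Z : PER P}

/-- A functional relation representing `f`. -/
noncomputable def graph (f : X ⟶ Y) : P.Pred (X.carrier ⨯ Y.carrier) := (Quotient.out f).1

theorem isFunctional_graph (f : X ⟶ Y) : IsFunctional X Y (graph f) := (Quotient.out f).2

/-- The morphism represented by a functional relation. -/
def ofRel (F : P.Pred (X.carrier ⨯ Y.carrier)) (hF : IsFunctional X Y F) : X ⟶ Y :=
  Quotient.mk (funRelSetoid X Y) ⟨F, hF⟩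

theorem ofRel_graph (f : X ⟶ Y) : ofRel (graph f) (isFunctional_graph f) = f := Quotient.out_eq f

/-- A single entailment suffices: between functional relations the converse follows from totality
and single-valuedness (`IsFunctional.le_symm`). -/
theorem ofRel_eq_iff {F G : P.Pred (X.carrier ⨯ Y.carrier)} {hF : IsFunctional X Y F}
    {hG : IsFunctional X Y G} : ofRel F hF = ofRel G hG ↔ F ≤ G :=
  ⟨fun h => Quotient.exact h, fun h => Quotient.sound h⟩

theorem graph_ofRel {F : P.Pred (X.carrier ⨯ Y.carrier)} (hF : IsFunctional X Y F) :
    graph (ofRel F hF) ≃ₚ F :=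
  ⟨ofRel_eq_iff.1 (ofRel_graph (ofRel F hF)), ofRel_eq_iff.1 (ofRel_graph (ofRel F hF)).symm⟩

theorem graph_comp (f : X ⟶ Y) (g : Y ⟶ Z) : graph (f ≫ g) ≃ₚ compRel (graph f) (graph g) := by
  have e : f ≫ g =
      ofRel _ ((isFunctional_graph f).comp (isFunctional_graph g)) := by
    conv_lhs => rw [← ofRel_graph f, ← ofRel_graph g]
    rfl
  rw [e]
  exact graph_ofRel _

/-- Two morphisms agree as soon as one graph contains the other. -/
theorem hom_ext_app {f g : X ⟶ Y} (h : ∀ {Γ : C} {δ : P.Pred Γ} {x : Γ ⟶ X.carrier}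
    {y : Γ ⟶ Y.carrier}, δ ≤ P.app (graph f) x y → δ ≤ P.app (graph g) x y) : f = g := by
  rw [← ofRel_graph f, ← ofRel_graph g, ofRel_eq_iff]
  exact le_of_forall_app h

variable {Γ : C} {δ : P.Pred Γ}

theorem le_graph_ofRel_iff {F : P.Pred (X.carrier ⨯ Y.carrier)} {hF : IsFunctional X Y F}
    {x : Γ ⟶ X.carrier} {y : Γ ⟶ Y.carrier} :
    δ ≤ P.app (graph (ofRel F hF)) x y ↔ δ ≤ P.app F x y :=
  ⟨fun h => h.trans (P.app_mono (graph_ofRel hF).1 _ _),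
    fun h => h.trans (P.app_mono (graph_ofRel hF).2 _ _)⟩

theorem le_graph_id_iff {x y : Γ ⟶ X.carrier} :
    δ ≤ P.app (graph (𝟙 X)) x y ↔ δ ≤ P.app X.rel x y :=
  le_graph_ofRel_iff (hF := X.isFunctional_rel)

theorem graph_comp_intro {f : X ⟶ Y} {g : Y ⟶ Z} {x : Γ ⟶ X.carrier} {y : Γ ⟶ Y.carrier}
    {z : Γ ⟶ Z.carrier} (h : δ ≤ P.app (graph f) x y) (h' : δ ≤ P.app (graph g) y z) :
    δ ≤ P.app (graph (f ≫ g)) x z :=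
  (compRel_intro y h h').trans (P.app_mono (graph_comp f g).2 _ _)

theorem graph_comp_elim {f : X ⟶ Y} {g : Y ⟶ Z} {x : Γ ⟶ X.carrier}
    {z : Γ ⟶ Z.carrier} {ψ : P.Pred Γ} (h : δ ≤ P.app (graph (f ≫ g)) x z)
    (h' : ∀ (Δ : C) (σ : Δ ⟶ Γ) (y : Δ ⟶ Y.carrier) (δ' : P.Pred Δ), δ' ≤ P.map σ δ →
      δ' ≤ P.app (graph f) (σ ≫ x) y → δ' ≤ P.app (graph g) y (σ ≫ z) → δ' ≤ P.map σ ψ) :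
    δ ≤ ψ :=
  compRel_elim (h.trans (P.app_mono (graph_comp f g).1 _ _)) h'

/-- If `f ≫ g` relates `x` to `z` and `f` relates `x` to `y`, then `g` relates `y` to `z`. -/
theorem graph_comp_cancel {f : X ⟶ Y} {g : Y ⟶ Z} {x : Γ ⟶ X.carrier} {y : Γ ⟶ Y.carrier}
    {z : Γ ⟶ Z.carrier} (h : δ ≤ P.app (graph (f ≫ g)) x z) (h' : δ ≤ P.app (graph f) x y) :
    δ ≤ P.app (graph g) y z := by
  refine graph_comp_elim h fun Δ σ y' δ' hδ h1 h2 => ?_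
  rw [P.le_map_app_iff]
  exact (isFunctional_graph g).relational_app h2
    ((isFunctional_graph f).singleValued_app h1 (P.app_tr hδ h'))
    ((isFunctional_graph g).strict_right h2)

/-! ### Images -/

/-- The predicate `∃ x, F(x, y)` for a representative `F` of `f`. -/
noncomputable def image (f : X ⟶ Y) : P.Pred Y.carrier := P.ex (conv (graph f))

theorem image_intro {f : X ⟶ Y} {x : Γ ⟶ X.carrier} {y : Γ ⟶ Y.carrier}
    (h : δ ≤ P.app (graph f) x y) : δ ≤ P.map y (image f) :=
  P.ex_intro x (le_app_conv_iff.2 h)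

theorem image_elim {f : X ⟶ Y} {y : Γ ⟶ Y.carrier} {ψ : P.Pred Γ} (h : δ ≤ P.map y (image f))
    (h' : ∀ (Δ : C) (σ : Δ ⟶ Γ) (x : Δ ⟶ X.carrier) (δ' : P.Pred Δ), δ' ≤ P.map σ δ →
      δ' ≤ P.app (graph f) x (σ ≫ y) → δ' ≤ P.map σ ψ) : δ ≤ ψ :=
  P.ex_elim h fun Δ σ x δ' hδ hx => h' Δ σ x δ' hδ (le_app_conv_iff.1 hx)

theorem isStrictRel_image (f : X ⟶ Y) : IsStrictRel Y (image f) :=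
  .of_map
    (fun h => image_elim h fun Δ σ x δ' _ h1 => by
      rw [P.le_map_app_iff]
      exact (isFunctional_graph f).strict_right h1)
    (fun h h' => image_elim h fun Δ σ x δ' hδ h1 => by
      rw [← P.le_map_comp_iff]
      exact image_intro ((isFunctional_graph f).relational_app h1
        ((isFunctional_graph f).strict_left h1) (P.app_tr hδ h')))

end Graph

end Calculus

/-! ### Finite limits of partial equivalence relations -/

section FiniteLimits

variable {C : Type u} [Category.{v} C] [HasFiniteProducts C]
  {P : IndexedPreorder.{u, v, w} C} [P.IsCoherent]

theorem isTop_top (A : Type w) [Preorder A] [IsDistPrelattice A] : IsTop (top A) :=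
  (IsDistPrelattice.exists_top (A := A)).choose_spec

theorem le_map_top {Γ X : C} {δ : P.Pred Γ} (x : Γ ⟶ X) : δ ≤ P.map x (top (P.Pred X)) :=
  (IsLatticeValued.isLatticeMap x).map_top (isTop_top _) δ

/-! ### The terminal object -/

variable (P) in
/-- The terminal partial equivalence relation. -/
noncomputable abbrev terminalPER : PER P :=
  PER.ofApp (X := ⊤_ C) (top _) (fun _ => le_map_top _) (fun _ _ => le_map_top _)

/-- Any two values are related in the terminal object, so relationality of g moves its value to that
of f. -/
theorem hom_terminalPER_ext {X : PER P} (f g : X ⟶ terminalPER P) : f = g := by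
  refine hom_ext_app fun {Γ δ x y} h => ?_
  refine (isFunctional_graph g).total_elim ((isFunctional_graph f).strict_left h)
    fun Δ σ y' δ' hδ h1 => ?_
  rw [P.le_map_app_iff]
  exact (isFunctional_graph g).relational_app h1 ((isFunctional_graph g).strict_left h1)
    (le_map_top _)

theorem exists_hom_terminalPER (X : PER P) : Nonempty (X ⟶ terminalPER P) := by
  have key : ∀ {Γ : C} {δ : P.Pred Γ} {x : Γ ⟶ X.carrier} {y : Γ ⟶ ⊤_ C},
      δ ≤ P.app (P.app X.rel prod.fst prod.fst) x y ↔ δ ≤ P.app X.rel x x := by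
    intro Γ δ x y
    refine (P.le_map_app_iff _ _ _).trans ?_
    simp
  refine ⟨ofRel (P.app X.rel prod.fst prod.fst) (.of_app ?_ ?_ ?_ ?_)⟩
  · exact fun h => ⟨key.1 h, le_map_top _⟩
  · exact fun h h' _ => key.2 (X.trans_app (X.symm_app h') h')
  · exact fun _ _ => le_map_top _
  · exact fun h => P.ex_intro (terminal.from _) (key.2 h)

theorem hasTerminal_PER : HasTerminal (PER P) :=
  (IsTerminal.ofUniqueHom (fun X => (exists_hom_terminalPER X).some)
    (fun _ _ => hom_terminalPER_ext _ _)).hasTerminal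

/-! ### Binary products -/

section Prod

variable {W X Y : PER P}

/-- The componentwise relation on a product. -/
noncomputable def prodRel (X Y : PER P) :
    P.Pred ((X.carrier ⨯ Y.carrier) ⨯ (X.carrier ⨯ Y.carrier)) :=
  P.app X.rel (prod.fst ≫ prod.fst) (prod.snd ≫ prod.fst) ⩓
    P.app Y.rel (prod.fst ≫ prod.snd) (prod.snd ≫ prod.snd)

theorem le_prodRel_iff {Γ : C} {δ : P.Pred Γ} {a b : Γ ⟶ X.carrier ⨯ Y.carrier} :
    δ ≤ P.app (prodRel X Y) a b ↔ δ ≤ P.app X.rel (a ≫ prod.fst) (b ≫ prod.fst) ∧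
      δ ≤ P.app Y.rel (a ≫ prod.snd) (b ≫ prod.snd) := by
  refine (P.le_map_meet_iff _).trans ?_
  simp [P.le_map_app_iff]

/-- The product of two partial equivalence relations. -/
noncomputable abbrev prodPER (X Y : PER P) : PER P :=
  PER.ofApp (prodRel X Y)
    (fun h => le_prodRel_iff.2
      ⟨X.symm_app (le_prodRel_iff.1 h).1, Y.symm_app (le_prodRel_iff.1 h).2⟩)
    (fun h h' => le_prodRel_iff.2
      ⟨X.trans_app (le_prodRel_iff.1 h).1 (le_prodRel_iff.1 h').1,
        Y.trans_app (le_prodRel_iff.1 h).2 (le_prodRel_iff.1 h').2⟩)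

/-- The graph of the first projection. -/
noncomputable def fstRel (X Y : PER P) : P.Pred ((X.carrier ⨯ Y.carrier) ⨯ X.carrier) :=
  P.app X.rel (prod.fst ≫ prod.fst) prod.snd ⩓
    P.app Y.rel (prod.fst ≫ prod.snd) (prod.fst ≫ prod.snd)

theorem le_fstRel_iff {Γ : C} {δ : P.Pred Γ} {a : Γ ⟶ X.carrier ⨯ Y.carrier}
    {x : Γ ⟶ X.carrier} : δ ≤ P.app (fstRel X Y) a x ↔ δ ≤ P.app X.rel (a ≫ prod.fst) x ∧
      δ ≤ P.app Y.rel (a ≫ prod.snd) (a ≫ prod.snd) := by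
  refine (P.le_map_meet_iff _).trans ?_
  simp [P.le_map_app_iff]

/-- The graph of the second projection. -/
noncomputable def sndRel (X Y : PER P) : P.Pred ((X.carrier ⨯ Y.carrier) ⨯ Y.carrier) :=
  P.app Y.rel (prod.fst ≫ prod.snd) prod.snd ⩓
    P.app X.rel (prod.fst ≫ prod.fst) (prod.fst ≫ prod.fst)

theorem le_sndRel_iff {Γ : C} {δ : P.Pred Γ} {a : Γ ⟶ X.carrier ⨯ Y.carrier}
    {y : Γ ⟶ Y.carrier} : δ ≤ P.app (sndRel X Y) a y ↔ δ ≤ P.app Y.rel (a ≫ prod.snd) y ∧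
      δ ≤ P.app X.rel (a ≫ prod.fst) (a ≫ prod.fst) := by
  refine (P.le_map_meet_iff _).trans ?_
  simp [P.le_map_app_iff]

/-- The first projection. -/
noncomputable def fstPER (X Y : PER P) : prodPER X Y ⟶ X :=
  ofRel (fstRel X Y) <| .of_app
    (fun h => by
      have h := le_fstRel_iff.1 h
      -- Here the conjunct y ∼ y of `fstRel` is needed: without it the relation would not be strict
      -- on the product.
      exact ⟨le_prodRel_iff.2 ⟨X.trans_app h.1 (X.symm_app h.1), h.2⟩,
        X.trans_app (X.symm_app h.1) h.1⟩)
    (fun h h1 h2 => by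
      have h := le_fstRel_iff.1 h
      have h1 := le_prodRel_iff.1 h1
      exact le_fstRel_iff.2 ⟨X.trans_app (X.symm_app h1.1) (X.trans_app h.1 h2),
        Y.trans_app (Y.symm_app h1.2) h1.2⟩)
    (fun h h' => X.trans_app (X.symm_app (le_fstRel_iff.1 h).1) (le_fstRel_iff.1 h').1)
    (fun h => P.ex_intro _ (le_fstRel_iff.2 (le_prodRel_iff.1 h)))

/-- The second projection. -/
noncomputable def sndPER (X Y : PER P) : prodPER X Y ⟶ Y :=
  ofRel (sndRel X Y) <| .of_app
    (fun h => by
      have h := le_sndRel_iff.1 h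
      exact ⟨le_prodRel_iff.2 ⟨h.2, Y.trans_app h.1 (Y.symm_app h.1)⟩,
        Y.trans_app (Y.symm_app h.1) h.1⟩)
    (fun h h1 h2 => by
      have h := le_sndRel_iff.1 h
      have h1 := le_prodRel_iff.1 h1
      exact le_sndRel_iff.2 ⟨Y.trans_app (Y.symm_app h1.2) (Y.trans_app h.1 h2),
        X.trans_app (X.symm_app h1.1) h1.1⟩)
    (fun h h' => Y.trans_app (Y.symm_app (le_sndRel_iff.1 h).1) (le_sndRel_iff.1 h').1)
    (fun h => P.ex_intro _ (le_sndRel_iff.2 (le_prodRel_iff.1 h).symm))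

theorem le_fstPER_iff {Γ : C} {δ : P.Pred Γ} {a : Γ ⟶ X.carrier ⨯ Y.carrier}
    {x : Γ ⟶ X.carrier} : δ ≤ P.app (graph (fstPER X Y)) a x ↔
      δ ≤ P.app X.rel (a ≫ prod.fst) x ∧ δ ≤ P.app Y.rel (a ≫ prod.snd) (a ≫ prod.snd) :=
  le_graph_ofRel_iff.trans le_fstRel_iff

theorem le_sndPER_iff {Γ : C} {δ : P.Pred Γ} {a : Γ ⟶ X.carrier ⨯ Y.carrier}
    {y : Γ ⟶ Y.carrier} : δ ≤ P.app (graph (sndPER X Y)) a y ↔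
      δ ≤ P.app Y.rel (a ≫ prod.snd) y ∧ δ ≤ P.app X.rel (a ≫ prod.fst) (a ≫ prod.fst) :=
  le_graph_ofRel_iff.trans le_sndRel_iff

/-- The graph of a pairing. -/
noncomputable def pairRel (f : W ⟶ X) (g : W ⟶ Y) :
    P.Pred (W.carrier ⨯ (X.carrier ⨯ Y.carrier)) :=
  P.app (graph f) prod.fst (prod.snd ≫ prod.fst) ⩓ P.app (graph g) prod.fst (prod.snd ≫ prod.snd)

theorem le_pairRel_iff {f : W ⟶ X} {g : W ⟶ Y} {Γ : C} {δ : P.Pred Γ} {a : Γ ⟶ W.carrier}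
    {b : Γ ⟶ X.carrier ⨯ Y.carrier} : δ ≤ P.app (pairRel f g) a b ↔
      δ ≤ P.app (graph f) a (b ≫ prod.fst) ∧ δ ≤ P.app (graph g) a (b ≫ prod.snd) := by
  refine (P.le_map_meet_iff _).trans ?_
  simp [P.le_map_app_iff]

/-- The pairing of two morphisms. -/
noncomputable def pairPER (f : W ⟶ X) (g : W ⟶ Y) : W ⟶ prodPER X Y :=
  ofRel (pairRel f g) <| .of_app
    (fun h => by
      have h := le_pairRel_iff.1 h
      exact ⟨(isFunctional_graph f).strict_left h.1, le_prodRel_iff.2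
        ⟨(isFunctional_graph f).strict_right h.1, (isFunctional_graph g).strict_right h.2⟩⟩)
    (fun h h1 h2 => by
      have h := le_pairRel_iff.1 h
      have h2 := le_prodRel_iff.1 h2
      exact le_pairRel_iff.2 ⟨(isFunctional_graph f).relational_app h.1 h1 h2.1,
        (isFunctional_graph g).relational_app h.2 h1 h2.2⟩)
    (fun h h' => by
      have h := le_pairRel_iff.1 h
      have h' := le_pairRel_iff.1 h'
      exact le_prodRel_iff.2 ⟨(isFunctional_graph f).singleValued_app h.1 h'.1,
        (isFunctional_graph g).singleValued_app h.2 h'.2⟩)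
    (fun h => by
      refine (isFunctional_graph f).total_elim h fun Δ σ x δ' hδ h1 => ?_
      refine (isFunctional_graph g).total_elim ((isFunctional_graph f).strict_left h1)
        fun Δ' τ y δ'' hδ' h2 => ?_
      rw [← P.le_map_comp_iff, ← P.le_map_comp_iff]
      refine P.ex_intro (prod.lift (τ ≫ x) y) (le_pairRel_iff.2 ⟨?_, ?_⟩)
      · simpa using P.app_tr hδ' h1
      · simpa using h2)

theorem le_pairPER_iff {f : W ⟶ X} {g : W ⟶ Y} {Γ : C} {δ : P.Pred Γ} {a : Γ ⟶ W.carrier}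
    {b : Γ ⟶ X.carrier ⨯ Y.carrier} : δ ≤ P.app (graph (pairPER f g)) a b ↔
      δ ≤ P.app (graph f) a (b ≫ prod.fst) ∧ δ ≤ P.app (graph g) a (b ≫ prod.snd) :=
  le_graph_ofRel_iff.trans le_pairRel_iff

theorem pairPER_fst (f : W ⟶ X) (g : W ⟶ Y) : pairPER f g ≫ fstPER X Y = f := by
  refine hom_ext_app fun h => graph_comp_elim h fun Δ σ b δ' hδ h1 h2 => ?_
  rw [P.le_map_app_iff]
  have h1 := le_pairPER_iff.1 h1
  exact (isFunctional_graph f).relational_app h1.1 ((isFunctional_graph f).strict_left h1.1)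
    (le_fstPER_iff.1 h2).1

theorem pairPER_snd (f : W ⟶ X) (g : W ⟶ Y) : pairPER f g ≫ sndPER X Y = g := by
  refine hom_ext_app fun h => graph_comp_elim h fun Δ σ b δ' hδ h1 h2 => ?_
  rw [P.le_map_app_iff]
  have h1 := le_pairPER_iff.1 h1
  exact (isFunctional_graph g).relational_app h1.2 ((isFunctional_graph g).strict_left h1.2)
    (le_sndPER_iff.1 h2).1

theorem eq_pairPER {f : W ⟶ X} {g : W ⟶ Y} {h : W ⟶ prodPER X Y} (hf : h ≫ fstPER X Y = f)
    (hg : h ≫ sndPER X Y = g) : h = pairPER f g := by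
  subst hf hg
  refine hom_ext_app fun h1 => le_pairPER_iff.2 ?_
  have h2 := le_prodRel_iff.1 ((isFunctional_graph h).strict_right h1)
  exact ⟨graph_comp_intro h1 (le_fstPER_iff.2 h2), graph_comp_intro h1 (le_sndPER_iff.2 h2.symm)⟩

theorem hasBinaryProducts_PER : HasBinaryProducts (PER P) :=
  have (X Y : PER P) : HasLimit (pair X Y) :=
    ⟨⟨BinaryFan.mk (fstPER X Y) (sndPER X Y), BinaryFan.IsLimit.mk _ pairPER pairPER_fst
      pairPER_snd fun _ _ _ => eq_pairPER⟩⟩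
  hasBinaryProducts_of_hasLimit_pair _

end Prod

/-! ### Comprehension and equalizers -/

section Restrict

variable {W X Y : PER P} {φ : P.Pred X.carrier}

/-- The restriction of a partial equivalence relation to a predicate. -/
noncomputable def restrictRel (X : PER P) (φ : P.Pred X.carrier) :
    P.Pred (X.carrier ⨯ X.carrier) :=
  X.rel ⩓ P.map prod.fst φ

theorem le_restrictRel_iff {Γ : C} {δ : P.Pred Γ} {x x' : Γ ⟶ X.carrier} :
    δ ≤ P.app (restrictRel X φ) x x' ↔ δ ≤ P.app X.rel x x' ∧ δ ≤ P.map x φ := by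
  refine (P.le_map_meet_iff _).trans (and_congr Iff.rfl ?_)
  rw [← P.le_map_comp_iff, prod.lift_fst]

/-- The object of `X` cut out by a strict relation. -/
noncomputable abbrev restrict (hφ : IsStrictRel X φ) : PER P :=
  PER.ofApp (restrictRel X φ)
    (fun h => by
      have h := le_restrictRel_iff.1 h
      exact le_restrictRel_iff.2 ⟨X.symm_app h.1, hφ.relational_app h.2 h.1⟩)
    (fun h h' => by
      have h := le_restrictRel_iff.1 h
      exact le_restrictRel_iff.2 ⟨X.trans_app h.1 (le_restrictRel_iff.1 h').1, h.2⟩)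

/-- The inclusion of `restrict hφ`. -/
noncomputable def incl (hφ : IsStrictRel X φ) : restrict hφ ⟶ X :=
  ofRel (restrictRel X φ) <| .of_app
    (fun h => by
      have h := le_restrictRel_iff.1 h
      exact ⟨le_restrictRel_iff.2 ⟨X.trans_app h.1 (X.symm_app h.1), h.2⟩,
        X.trans_app (X.symm_app h.1) h.1⟩)
    (fun h h1 h2 => by
      have h := le_restrictRel_iff.1 h
      have h1 := le_restrictRel_iff.1 h1
      exact le_restrictRel_iff.2 ⟨X.trans_app (X.symm_app h1.1) (X.trans_app h.1 h2),
        hφ.relational_app h1.2 h1.1⟩)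
    (fun h h' => by
      have h := le_restrictRel_iff.1 h
      have h' := le_restrictRel_iff.1 h'
      exact X.trans_app (X.symm_app h.1) h'.1)
    -- The witness is x itself: the graph of the inclusion is the relation of the restricted object.
    (fun {_ _ x} h => P.ex_intro x h)

theorem le_incl_iff {hφ : IsStrictRel X φ} {Γ : C} {δ : P.Pred Γ} {x x' : Γ ⟶ X.carrier} :
    δ ≤ P.app (graph (incl hφ)) x x' ↔ δ ≤ P.app X.rel x x' ∧ δ ≤ P.map x φ :=
  le_graph_ofRel_iff.trans le_restrictRel_iff

/-- The graph of `incl hφ` is the relation of `restrict hφ`, which represents the identity there.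
Composing with the inclusion thus changes only the declared target of a relation, which gives both
that `incl` is mono and that lifts through it exist. -/
theorem comp_incl_iff {hφ : IsStrictRel X φ} (h : W ⟶ restrict hφ) {Γ : C} {δ : P.Pred Γ}
    {a : Γ ⟶ W.carrier} {x : Γ ⟶ X.carrier} :
    δ ≤ P.app (graph (h ≫ incl hφ)) a x ↔ δ ≤ P.app (graph h) a x := by
  refine ⟨fun h1 => graph_comp_elim h1 fun Δ σ b δ' _ h2 h3 => ?_, fun h1 => ?_⟩
  · refine (P.le_map_app_iff _ _ _).2 ?_
    exact (isFunctional_graph h).relational_app h2 ((isFunctional_graph h).strict_left h2)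
      (le_restrictRel_iff.2 (le_incl_iff.1 h3))
  · exact graph_comp_intro h1 (le_incl_iff.2
      (le_restrictRel_iff.1 ((isFunctional_graph h).strict_right h1)))

instance mono_incl (hφ : IsStrictRel X φ) : Mono (incl hφ) where
  right_cancellation g h e := hom_ext_app fun h1 =>
    (comp_incl_iff h).1 (e ▸ (comp_incl_iff g).2 h1)

theorem image_incl (hφ : IsStrictRel X φ) : image (incl hφ) ≃ₚ φ := by
  constructor <;> refine le_of_map fun h => ?_
  · refine image_elim h fun Δ σ x δ' _ h1 => ?_
    have h1 := le_incl_iff.1 h1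
    rw [← P.le_map_comp_iff]
    exact hφ.relational_app h1.2 h1.1
  · exact image_intro (le_incl_iff.2 ⟨hφ.strict_app h, h⟩)

theorem exists_lift_incl (hφ : IsStrictRel X φ) (f : W ⟶ X) (hf : image f ≤ φ) :
    ∃ h : W ⟶ restrict hφ, h ≫ incl hφ = f := by
  have hF := isFunctional_graph f
  have key : ∀ {Γ : C} {δ : P.Pred Γ} {a : Γ ⟶ W.carrier} {x : Γ ⟶ X.carrier},
    δ ≤ P.app (graph f) a x → δ ≤ P.map x φ := fun h => (image_intro h).trans (P.map_mono _ hf)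
  -- The lift is the same relation, reread with the smaller target; `key` supplies the extra
  -- conjunct of the restricted relation.
  have hF' : IsFunctional W (restrict hφ) (graph (Y := X) f) :=
    .of_app (fun h => ⟨hF.strict_left h, le_restrictRel_iff.2 ⟨hF.strict_right h, key h⟩⟩)
      (fun h h1 h2 => hF.relational_app h h1 (le_restrictRel_iff.1 h2).1)
      (fun h h' => le_restrictRel_iff.2 ⟨hF.singleValued_app h h', key h⟩)
      (fun h => hF.total_app h)
  exact ⟨ofRel _ hF', hom_ext_app fun h =>
    le_graph_ofRel_iff (hF := hF').1 ((comp_incl_iff (ofRel _ hF')).1 h)⟩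

/-- The predicate `∃ y, F(x, y) ∧ G(x, y)` that cuts out the equalizer of two morphisms. -/
noncomputable def agree (f g : X ⟶ Y) : P.Pred X.carrier := P.ex (graph f ⩓ graph g)

theorem agree_intro {f g : X ⟶ Y} {Γ : C} {δ : P.Pred Γ} {x : Γ ⟶ X.carrier}
    {y : Γ ⟶ Y.carrier} (h : δ ≤ P.app (graph f) x y) (h' : δ ≤ P.app (graph g) x y) :
    δ ≤ P.map x (agree f g) :=
  P.ex_intro y ((P.le_map_meet_iff _).2 ⟨h, h'⟩)

theorem agree_elim {f g : X ⟶ Y} {Γ : C} {δ ψ : P.Pred Γ} {x : Γ ⟶ X.carrier}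
    (h : δ ≤ P.map x (agree f g)) (h' : ∀ (Δ : C) (σ : Δ ⟶ Γ) (y : Δ ⟶ Y.carrier)
      (δ' : P.Pred Δ), δ' ≤ P.map σ δ → δ' ≤ P.app (graph f) (σ ≫ x) y →
      δ' ≤ P.app (graph g) (σ ≫ x) y → δ' ≤ P.map σ ψ) : δ ≤ ψ :=
  P.ex_elim h fun Δ σ y δ' hδ hy =>
    h' Δ σ y δ' hδ ((P.le_map_meet_iff _).1 hy).1 ((P.le_map_meet_iff _).1 hy).2

theorem isStrictRel_agree (f g : X ⟶ Y) : IsStrictRel X (agree f g) :=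
  .of_map
    (fun h => agree_elim h fun Δ σ y δ' _ h1 _ => by
      rw [P.le_map_app_iff]
      exact (isFunctional_graph f).strict_left h1)
    (fun h h' => agree_elim h fun Δ σ y δ' hδ h1 h2 => by
      rw [← P.le_map_comp_iff]
      exact agree_intro
        ((isFunctional_graph f).relational_app h1 (P.app_tr hδ h')
          ((isFunctional_graph f).strict_right h1))
        ((isFunctional_graph g).relational_app h2 (P.app_tr hδ h')
          ((isFunctional_graph g).strict_right h2)))

theorem incl_agree_comp (f g : X ⟶ Y) :
    incl (isStrictRel_agree f g) ≫ f = incl (isStrictRel_agree f g) ≫ g := by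
  refine hom_ext_app fun h => graph_comp_elim h fun Δ σ x δ' _ h1 h2 => ?_
  have h3 := le_incl_iff.1 h1
  -- The predicate `agree f g` is moved along ∼ to x. The common value y found there is ∼ to the
  -- given value of f, since f is single-valued.
  refine agree_elim ((isStrictRel_agree f g).relational_app h3.2 h3.1)
    fun Δ' τ y δ'' hδ h4 h5 => ?_
  rw [← P.le_map_comp_iff]
  refine (P.le_map_app_iff _ _ _).2 (graph_comp_intro (y := τ ≫ x) ?_ ?_)
  · simpa using P.app_tr hδ h1
  refine (isFunctional_graph g).relational_app h5
    ((isFunctional_graph g).strict_left h5) ?_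
  simpa using (isFunctional_graph f).singleValued_app h4 (P.app_tr hδ h2)

theorem image_le_agree {f g : X ⟶ Y} {k : W ⟶ X} (hk : k ≫ f = k ≫ g) : image k ≤ agree f g := by
  refine le_of_map fun h => image_elim h fun Δ σ a δ' _ h1 => ?_
  refine (isFunctional_graph f).total_elim ((isFunctional_graph k).strict_right h1)
    fun Δ' τ y δ'' hδ h2 => ?_
  rw [← P.le_map_comp_iff, ← P.le_map_comp_iff, Category.assoc]
  have h3 := P.app_tr hδ h1
  refine agree_intro h2 (graph_comp_cancel ?_ h3)
  rw [← hk]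
  exact graph_comp_intro h3 h2

theorem hasEqualizers_PER : HasEqualizers (PER P) :=
  have {X Y : PER P} {f g : X ⟶ Y} : HasLimit (parallelPair f g) :=
    ⟨⟨Fork.ofι (incl (isStrictRel_agree f g)) (incl_agree_comp f g), Fork.IsLimit.mk' _ fun s => by
      have h := exists_lift_incl (isStrictRel_agree f g) s.ι (image_le_agree s.condition)
      exact ⟨h.choose, h.choose_spec, fun {m} hm =>
        (cancel_mono (incl (isStrictRel_agree f g))).1 (hm.trans h.choose_spec.symm)⟩⟩⟩
  hasEqualizers_of_hasLimit_parallelPair _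

end Restrict

theorem hasFiniteLimits_PER : HasFiniteLimits (PER P) :=
  have := hasTerminal_PER (P := P)
  have := hasBinaryProducts_PER (P := P)
  have := hasEqualizers_PER (P := P)
  have := hasFiniteProducts_of_has_binary_and_terminal (C := PER P)
  hasFiniteLimits_of_hasEqualizers_and_finite_products

/-! ### Elements of pullbacks -/

/-- Compatible elements come from an element of the pullback. -/
theorem isPullback_elim {W X Y Z : PER P} {p : W ⟶ X} {q : W ⟶ Y} {f : X ⟶ Z} {g : Y ⟶ Z}
    (sq : IsPullback p q f g) {Γ : C} {δ ψ : P.Pred Γ} {x : Γ ⟶ X.carrier} {y : Γ ⟶ Y.carrier}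
    {z : Γ ⟶ Z.carrier} (hx : δ ≤ P.app (graph f) x z) (hy : δ ≤ P.app (graph g) y z)
    (h' : ∀ (Δ : C) (σ : Δ ⟶ Γ) (w : Δ ⟶ W.carrier) (δ' : P.Pred Δ), δ' ≤ P.map σ δ →
      δ' ≤ P.app (graph p) w (σ ≫ x) → δ' ≤ P.app (graph q) w (σ ≫ y) → δ' ≤ P.map σ ψ) :
    δ ≤ ψ := by
  have hS := isStrictRel_agree (fstPER X Y ≫ f) (sndPER X Y ≫ g)
  -- The given pullback is compared with the explicit one, the equalizer inside the product; the
  -- pair (x, y) is an element of the latter.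
  let l := sq.lift (incl hS ≫ fstPER X Y) (incl hS ≫ sndPER X Y) (by
    simpa using incl_agree_comp (fstPER X Y ≫ f) (sndPER X Y ≫ g))
  have hxx : δ ≤ P.app X.rel x x := (isFunctional_graph f).strict_left hx
  have hyy : δ ≤ P.app Y.rel y y := (isFunctional_graph g).strict_left hy
  have e1 : δ ≤ P.app (graph (fstPER X Y)) (prod.lift x y) x :=
    le_fstPER_iff.2 (by simpa using ⟨hxx, hyy⟩)
  have e2 : δ ≤ P.app (graph (sndPER X Y)) (prod.lift x y) y :=
    le_sndPER_iff.2 (by simpa using ⟨hyy, hxx⟩)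
  have e3 : δ ≤ P.map (prod.lift x y) (agree (fstPER X Y ≫ f) (sndPER X Y ≫ g)) :=
    agree_intro (graph_comp_intro e1 hx) (graph_comp_intro e2 hy)
  have e4 : δ ≤ P.app (prodRel X Y) (prod.lift x y) (prod.lift x y) :=
    (isFunctional_graph (fstPER X Y)).strict_left e1
  have e5 := le_incl_iff (hφ := hS).2 ⟨e4, e3⟩
  -- A value w of l at (x, y) is the element sought; cancelling l computes its two projections.
  refine (isFunctional_graph l).total_elim ((isFunctional_graph (incl hS)).strict_left e5)
    fun Δ σ w δ' hδ h1 => h' Δ σ w δ' hδ ?_ ?_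
  · refine graph_comp_cancel (f := l) ?_ h1
    rw [sq.lift_fst]
    exact graph_comp_intro (P.app_tr hδ e5) (P.app_tr hδ e1)
  · refine graph_comp_cancel (f := l) ?_ h1
    rw [sq.lift_snd]
    exact graph_comp_intro (P.app_tr hδ e5) (P.app_tr hδ e2)

end FiniteLimits

/-! ### Bounds of pairs in a preorder -/

section PairBounds

variable {A : Type w} [Preorder A] {a b c : A}

theorem isLUB_pair_iff : IsLUB {a, b} c ↔ a ≤ c ∧ b ≤ c ∧ ∀ d, a ≤ d → b ≤ d → c ≤ d := by
  simp [IsLUB, IsLeast, upperBounds, lowerBounds, and_assoc]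

theorem isGLB_pair_iff : IsGLB {a, b} c ↔ c ≤ a ∧ c ≤ b ∧ ∀ d, d ≤ a → d ≤ b → d ≤ c := by
  simp [IsGLB, IsGreatest, upperBounds, lowerBounds, and_assoc]

end PairBounds

/-! ### The half of Frobenius and Beck–Chevalley that is not formal -/

section Formal

variable {C : Type u} [Category.{v} C] [HasFiniteProducts C] {P : IndexedPreorder.{u, v, w} C}
  [P.HasLeftAdjoints]

/-- One half of the Frobenius condition is automatic. -/
theorem frobenius_of_le [P.IsLatticeValued] (h : ∀ {A B : C} (α : P.Pred A) (β : P.Pred (A ⨯ B)),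
    α ⩓ P.ex β ≤ P.ex (P.map prod.fst α ⩓ β)) : P.Frobenius := by
  refine fun {A B} α β => ⟨(P.ex_gc A B _ _).2 ?_, h α β⟩
  have h1 := isGLB_pair_iff.1 ((IsLatticeValued.isLatticeMap (P := P)
    (prod.fst : A ⨯ B ⟶ A)).map_meet (meet_isGLB α (P.ex β)))
  have h2 := le_meet_iff.1 (le_refl (P.map (prod.fst : A ⨯ B ⟶ A) α ⩓ β))
  exact h1.2.2 _ h2.1 (h2.2.trans ((P.ex_gc A B).le_u_l β))

/-- One half of the Beck–Chevalley condition is automatic. -/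
theorem beckChevalley_of_le (h : ∀ {B D Y Z : C} (f : B ⨯ Y ⟶ D ⨯ Z) (g : B ⟶ D),
    IsPullback f (prod.fst : B ⨯ Y ⟶ B) (prod.fst : D ⨯ Z ⟶ D) g →
    ∀ a : P.Pred (D ⨯ Z), P.map g (P.ex a) ≤ P.ex (P.map f a)) : P.BeckChevalley := by
  refine fun {B D Y Z} f g sq a => ⟨(P.ex_gc B Y _ _).2 ?_, h f g sq a⟩
  refine (P.map_mono f ((P.ex_gc D Z).le_u_l a)).trans ((P.map_comp f prod.fst _).2.trans ?_)
  rw [sq.w]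
  exact (P.map_comp _ _ _).1

end Formal

/-! ### The hyperdoctrine of strict relations and its comparison with subobjects -/

section Strict

variable {C : Type u} [Category.{v} C] [HasFiniteProducts C]
  {P : IndexedPreorder.{u, v, w} C} [P.IsCoherent]

/-- The strict relations on `X`. -/
abbrev StrictRel (X : PER P) : Type w := {φ : P.Pred X.carrier // IsStrictRel X φ}

variable {W X Y Z : PER P}

/-! ### The lattice of strict relations -/

/-- Strict relations are closed under the binary joins and meets and the bottom of P, so these
operations may be computed in P. Only the top differs: it is x ∼ x. -/
theorem isStrictRel_of_isLUB {a b : StrictRel X} {j : P.Pred X.carrier} (h : IsLUB {a.1, b.1} j) :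
    IsStrictRel X j :=
  .of_map
    (fun {_ _ x} hx => map_join_elim x h hx (fun _ _ ha => a.2.strict_app ha)
      (fun _ _ hb => b.2.strict_app hb))
    (fun {_ _ x x'} hx hxx' => map_join_elim x h hx
      (fun _ hδ ha => (a.2.relational_app ha (hδ.trans hxx')).trans
        (P.map_mono x' (isLUB_pair_iff.1 h).1))
      (fun _ hδ hb => (b.2.relational_app hb (hδ.trans hxx')).trans
        (P.map_mono x' (isLUB_pair_iff.1 h).2.1)))

theorem isStrictRel_of_isGLB {a b : StrictRel X} {m : P.Pred X.carrier} (h : IsGLB {a.1, b.1} m) :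
    IsStrictRel X m :=
  .of_map (fun {_ _ x} hx => a.2.strict_app (hx.trans (P.map_mono x (isGLB_pair_iff.1 h).1)))
    (fun {_ _ x x'} hx hxx' =>
      (isGLB_pair_iff.1 ((IsLatticeValued.isLatticeMap x').map_meet h)).2.2 _
        (a.2.relational_app (hx.trans (P.map_mono x (isGLB_pair_iff.1 h).1)) hxx')
        (b.2.relational_app (hx.trans (P.map_mono x (isGLB_pair_iff.1 h).2.1)) hxx'))

theorem isStrictRel_of_isBot {b : P.Pred X.carrier} (h : IsBot b) : IsStrictRel X b :=
  .of_map (fun {_ _ x} hx => hx.trans ((IsLatticeValued.isLatticeMap x).map_bot h _))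
    (fun {_ _ x _} hx _ => hx.trans ((IsLatticeValued.isLatticeMap x).map_bot h _))

theorem isStrictRel_rel (X : PER P) : IsStrictRel X (P.app X.rel (𝟙 _) (𝟙 _)) :=
  have key {Γ : C} {δ : P.Pred Γ} {x : Γ ⟶ X.carrier} :
      δ ≤ P.map x (P.app X.rel (𝟙 _) (𝟙 _)) ↔ δ ≤ P.app X.rel x x := by
    rw [P.le_map_app_iff, Category.comp_id]
  .of_map (fun h => key.1 h) (fun _ h => key.2 (X.trans_app (X.symm_app h) h))

theorem isTop_strictRel_iff {t : StrictRel X} : IsTop t ↔ P.app X.rel (𝟙 _) (𝟙 _) ≤ t.1 :=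
  ⟨fun h => h ⟨_, isStrictRel_rel X⟩, fun h c => c.2.strict.trans h⟩

theorem isBot_strictRel_iff {b : StrictRel X} : IsBot b ↔ IsBot b.1 := by
  refine ⟨fun h c => ?_, fun h c => h c.1⟩
  obtain ⟨b', hb'⟩ := IsDistPrelattice.exists_bot (A := P.Pred X.carrier)
  exact le_trans (h ⟨b', isStrictRel_of_isBot hb'⟩) (hb' c)

/-- The join in P is itself strict, so a least strict upper bound lies below it and is least among
all predicates. The same comparison works for bottoms and meets, and lets distributivity be
inherited from P. -/
theorem isLUB_strictRel_iff {a b j : StrictRel X} : IsLUB {a, b} j ↔ IsLUB {a.1, b.1} j.1 := by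
  constructor
  · intro h
    obtain ⟨k, hk⟩ := IsDistPrelattice.exists_join a.1 b.1
    have h := isLUB_pair_iff.1 h
    have hk' := isLUB_pair_iff.1 hk
    exact isLUB_pair_iff.2 ⟨h.1, h.2.1, fun d ha hb =>
      le_trans (h.2.2 ⟨k, isStrictRel_of_isLUB hk⟩ hk'.1 hk'.2.1) (hk'.2.2 d ha hb)⟩
  · intro h
    have h := isLUB_pair_iff.1 h
    exact isLUB_pair_iff.2 ⟨h.1, h.2.1, fun d ha hb => h.2.2 d.1 ha hb⟩

theorem isGLB_strictRel_iff {a b m : StrictRel X} : IsGLB {a, b} m ↔ IsGLB {a.1, b.1} m.1 := by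
  constructor
  · intro h
    have hk := meet_isGLB a.1 b.1
    have h := isGLB_pair_iff.1 h
    have hk' := isGLB_pair_iff.1 hk
    exact isGLB_pair_iff.2 ⟨h.1, h.2.1, fun d ha hb =>
      (hk'.2.2 d ha hb).trans (h.2.2 ⟨_, isStrictRel_of_isGLB hk⟩ hk'.1 hk'.2.1)⟩
  · intro h
    have h := isGLB_pair_iff.1 h
    exact isGLB_pair_iff.2 ⟨h.1, h.2.1, fun d ha hb => h.2.2 d.1 ha hb⟩

instance isDistPrelattice_strictRel (X : PER P) : IsDistPrelattice (StrictRel X) where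
  exists_top := ⟨⟨_, isStrictRel_rel X⟩, isTop_strictRel_iff.2 le_rfl⟩
  exists_bot :=
    have ⟨b, hb⟩ := IsDistPrelattice.exists_bot (A := P.Pred X.carrier)
    ⟨⟨b, isStrictRel_of_isBot hb⟩, isBot_strictRel_iff.2 hb⟩
  exists_meet a b :=
    have ⟨m, hm⟩ := IsDistPrelattice.exists_meet a.1 b.1
    ⟨⟨m, isStrictRel_of_isGLB hm⟩, isGLB_strictRel_iff.2 hm⟩
  exists_join a b :=
    have ⟨j, hj⟩ := IsDistPrelattice.exists_join a.1 b.1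
    ⟨⟨j, isStrictRel_of_isLUB hj⟩, isLUB_strictRel_iff.2 hj⟩
  distrib hs hm hp hq :=
    isLUB_strictRel_iff.2 (IsDistPrelattice.distrib (isLUB_strictRel_iff.1 hs)
      (isGLB_strictRel_iff.1 hm) (isGLB_strictRel_iff.1 hp) (isGLB_strictRel_iff.1 hq))

/-- Reindexing of strict relations along `f`. -/
noncomputable def reindex (f : X ⟶ Y) (φ : StrictRel Y) : StrictRel X :=
  (strictRelations P).map f φ

theorem reindex_mono (f : X ⟶ Y) : Monotone (reindex f) := (strictRelations P).map_mono f

section Elements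

variable {f : X ⟶ Y} {Γ : C} {δ ψ : P.Pred Γ} {x : Γ ⟶ X.carrier} {y : Γ ⟶ Y.carrier}

theorem reindex_intro {φ : StrictRel Y} (h : δ ≤ P.app (graph f) x y) (h' : δ ≤ P.map y φ.1) :
    δ ≤ P.map x (reindex f φ).1 :=
  preimage_intro y h h'

theorem reindex_elim {φ : StrictRel Y} (h : δ ≤ P.map x (reindex f φ).1)
    (h' : ∀ (Δ : C) (σ : Δ ⟶ Γ) (y : Δ ⟶ Y.carrier) (δ' : P.Pred Δ), δ' ≤ P.map σ δ →
      δ' ≤ P.app (graph f) (σ ≫ x) y → δ' ≤ P.map y φ.1 → δ' ≤ P.map σ ψ) : δ ≤ ψ :=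
  preimage_elim h h'

/-- Single-valuedness lets the existential in reindexing be read universally: φ holds at every value
of f at x, not merely at some value. Preservation of meets and one half of the adjunction with
direct images depend on this. -/
theorem reindex_cancel {φ : StrictRel Y} (h : δ ≤ P.map x (reindex f φ).1)
    (h' : δ ≤ P.app (graph f) x y) : δ ≤ P.map y φ.1 := by
  refine reindex_elim h fun Δ σ y' δ' hδ h1 h2 => ?_
  rw [← P.le_map_comp_iff]
  exact φ.2.relational_app h2 ((isFunctional_graph f).singleValued_app h1 (P.app_tr hδ h'))

end Elements

/-- The top is preserved by totality and meets by single-valuedness (`reindex_cancel`); bottom and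
joins are preserved because ∃ and ∧ commute with them. -/
theorem isLatticeMap_reindex (f : X ⟶ Y) : IsLatticeMap (reindex f) where
  monotone := reindex_mono f
  map_top {t} ht := isTop_strictRel_iff.2 <| le_of_map fun {Γ δ x} h => by
    have h := (isStrictRel_rel X).strict_app h
    refine (isFunctional_graph f).total_elim h fun Δ σ y δ' hδ h1 => ?_
    rw [← P.le_map_comp_iff]
    refine reindex_intro h1 (le_trans ?_ (P.map_mono y (isTop_strictRel_iff.1 ht)))
    rw [P.le_map_app_iff, Category.comp_id]
    exact (isFunctional_graph f).strict_right h1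
  map_bot {b} hb c := le_of_map fun {Γ δ x} h => reindex_elim h fun Δ σ y δ' hδ h1 h2 =>
    h2.trans ((IsLatticeValued.isLatticeMap y).map_bot (isBot_strictRel_iff.1 hb) _)
  map_meet {a b m} hm := isGLB_pair_iff.2 ⟨reindex_mono f (isGLB_pair_iff.1 hm).1,
    reindex_mono f (isGLB_pair_iff.1 hm).2.1, fun d ha hb => le_of_map fun {Γ δ x} h => by
      have h1 := h.trans (P.map_mono x hb)
      refine reindex_elim (h.trans (P.map_mono x ha)) fun Δ σ y δ' hδ h2 h3 => ?_
      rw [← P.le_map_comp_iff]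
      have h4 := reindex_cancel (P.map_tr hδ h1) h2
      exact reindex_intro h2 ((isGLB_pair_iff.1 ((IsLatticeValued.isLatticeMap y).map_meet
        (isGLB_strictRel_iff.1 hm))).2.2 _ h3 h4)⟩
  map_join {a b j} hj := isLUB_pair_iff.2 ⟨reindex_mono f (isLUB_pair_iff.1 hj).1,
    reindex_mono f (isLUB_pair_iff.1 hj).2.1, fun d ha hb => le_of_map fun {Γ δ x} h => by
      refine reindex_elim h fun Δ σ y δ' hδ h2 h3 => ?_
      rw [← P.le_map_comp_iff]
      exact map_join_elim y (isLUB_strictRel_iff.1 hj) h3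
        (fun δ'' hδ' h4 => (reindex_intro (hδ'.trans h2) h4).trans (P.map_mono _ ha))
        (fun δ'' hδ' h4 => (reindex_intro (hδ'.trans h2) h4).trans (P.map_mono _ hb))⟩

instance isLatticeValued_strictRelations : (strictRelations P).IsLatticeValued where
  isDistPrelattice X := isDistPrelattice_strictRel X
  isLatticeMap f := isLatticeMap_reindex f

/-! ### Direct images -/

/-- The direct image `∃ x, F(x, y) ∧ φ(x)` of a strict relation. -/
noncomputable def dirImage (f : X ⟶ Y) (φ : StrictRel X) : StrictRel Y :=
  ⟨preimage (conv (graph f)) φ.1, .of_map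
    (fun h => preimage_elim h fun Δ σ x δ' _ h1 _ => by
      rw [P.le_map_app_iff]
      exact (isFunctional_graph f).strict_right (le_app_conv_iff.1 h1))
    (fun h h' => preimage_elim h fun Δ σ x δ' hδ h1 h2 => by
      rw [← P.le_map_comp_iff]
      have h1 := le_app_conv_iff.1 h1
      exact preimage_intro x (le_app_conv_iff.2 ((isFunctional_graph f).relational_app h1
        ((isFunctional_graph f).strict_left h1) (P.app_tr hδ h'))) h2)⟩

section Elements

variable {f : X ⟶ Y} {Γ : C} {δ ψ : P.Pred Γ} {x : Γ ⟶ X.carrier} {y : Γ ⟶ Y.carrier}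

theorem dirImage_intro {φ : StrictRel X} (h : δ ≤ P.app (graph f) x y) (h' : δ ≤ P.map x φ.1) :
    δ ≤ P.map y (dirImage f φ).1 :=
  preimage_intro x (le_app_conv_iff.2 h) h'

theorem dirImage_elim {φ : StrictRel X} (h : δ ≤ P.map y (dirImage f φ).1)
    (h' : ∀ (Δ : C) (σ : Δ ⟶ Γ) (x : Δ ⟶ X.carrier) (δ' : P.Pred Δ), δ' ≤ P.map σ δ →
      δ' ≤ P.app (graph f) x (σ ≫ y) → δ' ≤ P.map x φ.1 → δ' ≤ P.map σ ψ) : δ ≤ ψ :=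
  preimage_elim h fun Δ σ x δ' hδ h1 h2 => h' Δ σ x δ' hδ (le_app_conv_iff.1 h1) h2

end Elements

/-- The passage to the right uses that f is total, the passage back that it is single-valued. No
property of projections enters. -/
theorem gc_dirImage_reindex (f : X ⟶ Y) : GaloisConnection (dirImage f) (reindex f) := by
  intro φ ψ
  constructor
  · refine fun h => le_of_map fun {Γ δ x} hx => ?_
    refine (isFunctional_graph f).total_elim (φ.2.strict_app hx) fun Δ σ y δ' hδ h1 => ?_
    rw [← P.le_map_comp_iff]
    exact reindex_intro h1 ((dirImage_intro h1 (P.map_tr hδ hx)).trans (P.map_mono y h))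
  · refine fun h => le_of_map fun {Γ δ y} hy => dirImage_elim hy fun Δ σ x δ' _ h1 h2 => ?_
    rw [← P.le_map_comp_iff]
    exact reindex_cancel (h2.trans (P.map_mono x h)) h1

/-- Direct images satisfy the Frobenius condition. -/
theorem le_dirImage_meet (f : X ⟶ Y) (α : StrictRel Y) (β : StrictRel X) {c : StrictRel Y}
    (hα : c ≤ α) (hβ : c ≤ dirImage f β) : c ≤ dirImage f (reindex f α ⩓ β) :=
  le_of_map fun {Γ δ y} hy => by
    refine dirImage_elim (hy.trans (P.map_mono y hβ)) fun Δ σ x δ' hδ h1 h2 => ?_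
    rw [← P.le_map_comp_iff]
    have h3 := isGLB_strictRel_iff.1 (meet_isGLB (reindex f α) β)
    exact dirImage_intro h1 ((isGLB_pair_iff.1 ((IsLatticeValued.isLatticeMap x).map_meet h3)).2.2
      _ (reindex_intro h1 (P.map_tr hδ (hy.trans (P.map_mono y hα)))) h2)

/-- Direct images satisfy the Beck–Chevalley condition for all pullback squares. -/
theorem reindex_dirImage_le {p : W ⟶ X} {q : W ⟶ Y} {f : X ⟶ Z} {g : Y ⟶ Z}
    (sq : IsPullback p q f g) (φ : StrictRel X) :
    reindex g (dirImage f φ) ≤ dirImage q (reindex p φ) :=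
  le_of_map fun {Γ δ y} hy => by
    refine reindex_elim hy fun Δ σ z δ' _ h1 h2 => ?_
    refine dirImage_elim h2 fun Δ' τ x δ'' hδ h3 h4 => ?_
    have h5 := P.app_tr hδ h1
    refine isPullback_elim sq h3 h5 fun Δ'' ρ w δ₃ hδ' h6 h7 => ?_
    rw [← P.le_map_comp_iff, ← P.le_map_comp_iff, ← P.le_map_comp_iff]
    exact dirImage_intro (by simpa using h7) (reindex_intro h6 (P.map_tr hδ' h4))

section Coherent

variable [HasFiniteLimits (PER P)]

instance hasLeftAdjoints_strictRelations : (strictRelations P).HasLeftAdjoints where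
  exists_left_adjoint X Y := ⟨dirImage (prod.fst : X ⨯ Y ⟶ X), gc_dirImage_reindex _⟩

/-- Left adjoints are unique up to `≃ₚ`, so the chosen quantifier may be replaced by the direct
image, for which Frobenius and Beck–Chevalley are known. -/
theorem ex_strictRelations {X Y : PER P} (φ : StrictRel (X ⨯ Y)) :
    (strictRelations P).ex φ ≃ₚ dirImage (prod.fst : X ⨯ Y ⟶ X) φ :=
  ⟨((strictRelations P).ex_gc X Y _ _).2 ((gc_dirImage_reindex prod.fst).le_u_l φ),
    (gc_dirImage_reindex prod.fst _ _).2 (((strictRelations P).ex_gc X Y).le_u_l φ)⟩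

theorem frobenius_strictRelations : (strictRelations P).Frobenius :=
  frobenius_of_le fun α β => by
    have hm := le_meet_iff.1 (le_refl (α ⩓ (strictRelations P).ex β))
    refine le_trans ?_ (ex_strictRelations _).2
    exact le_dirImage_meet prod.fst α β hm.1 (hm.2.trans (ex_strictRelations β).1)

theorem beckChevalley_strictRelations : (strictRelations P).BeckChevalley :=
  beckChevalley_of_le fun f g sq a => by
    refine le_trans ?_ (ex_strictRelations _).2
    exact ((strictRelations P).map_mono g (ex_strictRelations a).1).trans
      (reindex_dirImage_le sq a)

end Coherent

/-! ### Subobjects and strict relations -/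

theorem image_comp_le (f : X ⟶ Y) (g : Y ⟶ Z) : image (f ≫ g) ≤ image g :=
  le_of_map fun h => image_elim h fun Δ σ x δ' _ h1 => graph_comp_elim h1
    fun Δ' τ y δ'' _ _ h3 => by
      rw [← P.le_map_comp_iff, ← P.le_map_comp_iff, Category.assoc]
      exact image_intro h3

/-- The identities form a kernel pair of a mono, so elements with equal value come from one element
w, with w ∼ x and w ∼ x'. -/
theorem injective_of_mono (m : X ⟶ Y) [Mono m] {Γ : C} {δ : P.Pred Γ} {x x' : Γ ⟶ X.carrier}
    {y : Γ ⟶ Y.carrier} (h : δ ≤ P.app (graph m) x y) (h' : δ ≤ P.app (graph m) x' y) :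
    δ ≤ P.app X.rel x x' :=
  isPullback_elim (IsKernelPair.id_of_mono m) h h' fun Δ σ w δ' _ h1 h2 => by
    rw [P.le_map_app_iff]
    exact X.trans_app (X.symm_app (le_graph_id_iff.1 h1)) (le_graph_id_iff.1 h2)

/-- The factor is the graph of f followed by the converse of that of m. It is single-valued because
m is injective, and total because every value of f lies in the image of m. -/
theorem exists_factor_of_mono (m : X ⟶ Y) [Mono m] (f : W ⟶ Y) (h : image f ≤ image m) :
    ∃ k, k ≫ m = f := by
  have hF := isFunctional_graph f
  have hm := isFunctional_graph m
  have hK : IsFunctional W X (compRel (graph f) (conv (graph m))) := .of_app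
    (fun h => ⟨compRel_elim h fun Δ σ y δ' _ h1 _ => by
        rw [P.le_map_app_iff]
        exact hF.strict_left h1,
      compRel_elim h fun Δ σ y δ' _ _ h2 => by
        rw [P.le_map_app_iff]
        exact hm.strict_left (le_app_conv_iff.1 h2)⟩)
    (fun h hw hx => compRel_elim h fun Δ σ y δ' hδ h1 h2 => by
      rw [P.le_map_app_iff]
      have h2 := le_app_conv_iff.1 h2
      exact compRel_intro y (hF.relational_app h1 (P.app_tr hδ hw) (hF.strict_right h1))
        (le_app_conv_iff.2 (hm.relational_app h2 (P.app_tr hδ hx) (hm.strict_right h2))))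
    (fun h h' => compRel_elim h fun Δ σ y δ' hδ h1 h2 => compRel_elim (P.app_tr hδ h')
      fun Δ' τ y' δ'' hδ' h3 h4 => by
        rw [← P.le_map_comp_iff, P.le_map_app_iff]
        have h2 := P.app_tr hδ' (le_app_conv_iff.1 h2)
        have h5 := hF.singleValued_app h3 (P.app_tr hδ' h1)
        have h4 := le_app_conv_iff.1 h4
        have h6 := hm.relational_app h4 (hm.strict_left h4) h5
        simpa using injective_of_mono m h2 h6)
    (fun {_ _ w} hw => hF.total_elim hw fun Δ σ y δ' hδ h1 => image_elim
      ((image_intro h1).trans (P.map_mono y h)) fun Δ' τ x δ'' hδ' h2 => by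
        rw [← P.le_map_comp_iff, ← P.le_map_comp_iff]
        exact P.ex_intro x (compRel_intro (τ ≫ y) (by simpa using P.app_tr hδ' h1)
          (le_app_conv_iff.2 h2)))
  refine ⟨ofRel _ hK, hom_ext_app fun h => graph_comp_elim h fun Δ σ x δ' _ h1 h2 =>
    compRel_elim (le_graph_ofRel_iff.1 h1) fun Δ' τ y δ'' hδ h3 h4 => ?_⟩
  rw [← P.le_map_comp_iff, P.le_map_app_iff]
  have h5 := hm.singleValued_app (le_app_conv_iff.1 h4) (P.app_tr hδ h2)
  simpa using hF.relational_app h3 (hF.strict_left h3) h5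

/-- Reduces the comparison of subobjects to that of predicates. -/
theorem subobject_le_iff {S T : Subobject X} : S ≤ T ↔ image S.arrow ≤ image T.arrow := by
  constructor
  · intro h
    rw [← Subobject.ofLE_arrow h]
    exact image_comp_le _ _
  · intro h
    obtain ⟨k, hk⟩ := exists_factor_of_mono T.arrow S.arrow h
    exact Subobject.le_of_comm k hk

theorem image_mk_arrow (m : X ⟶ Y) [Mono m] : image (Subobject.mk m).arrow ≃ₚ image m := by
  constructor
  · conv_lhs => rw [← Subobject.underlyingIso_hom_comp_eq_mk m]
    exact image_comp_le _ _
  · conv_lhs => rw [← Subobject.underlyingIso_arrow m]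
    exact image_comp_le _ _

/-- Applied to the arrow of a subobject, this is the naturality of the passage from subobjects to
strict relations. -/
theorem image_of_isPullback {p : W ⟶ X} {q : W ⟶ Y} {f : X ⟶ Z} {g : Y ⟶ Z}
    (sq : IsPullback p q f g) :
    image q ≃ₚ (reindex g ⟨image f, isStrictRel_image f⟩).1 := by
  constructor
  · refine le_of_map fun h => image_elim h fun Δ σ w δ' _ h1 => ?_
    refine (isFunctional_graph (p ≫ f)).total_elim ((isFunctional_graph q).strict_left h1)
      fun Δ' τ z δ'' hδ h2 => ?_
    rw [← P.le_map_comp_iff, ← P.le_map_comp_iff, Category.assoc]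
    refine reindex_intro (y := z) ?_ ((image_intro h2).trans (P.map_mono z (image_comp_le p f)))
    -- Now z is a value of q followed by g at w; cancelling q makes it a value of g.
    rw [sq.w] at h2
    exact graph_comp_cancel h2 (P.app_tr hδ h1)
  · refine le_of_map fun h => reindex_elim h fun Δ σ z δ' _ h1 h2 => ?_
    refine image_elim h2 fun Δ' τ x δ'' hδ h3 => ?_
    refine isPullback_elim sq h3 (P.app_tr hδ h1) fun Δ'' ρ w δ₃ _ _ h5 => ?_
    rw [← P.le_map_comp_iff, ← P.le_map_comp_iff, ← P.le_map_comp_iff]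
    exact image_intro (by simpa using h5)

/-- Subobjects correspond to strict relations. -/
noncomputable def subobjectsIso [HasFiniteLimits (PER P)] :
    (subobjects (PER P)).Iso (strictRelations P) where
  hom X S := ⟨image (Subobject.arrow S), isStrictRel_image _⟩
  inv X φ := Subobject.mk (incl (Subtype.prop φ))
  hom_mono X _ _ h := subobject_le_iff.1 h
  inv_mono X φ ψ h := subobject_le_iff.2 <|
    ((image_mk_arrow _).1.trans (image_incl _).1).trans
      (le_trans h ((image_incl _).2.trans (image_mk_arrow _).2))
  hom_inv X S :=
    ⟨subobject_le_iff.2 ((image_mk_arrow _).1.trans (image_incl _).1),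
      subobject_le_iff.2 ((image_incl _).2.trans (image_mk_arrow _).2)⟩
  inv_hom X φ := ⟨(image_mk_arrow _).1.trans (image_incl _).1,
    (image_incl _).2.trans (image_mk_arrow _).2⟩
  hom_natural f S := image_of_isPullback (Subobject.isPullback f S)
  inv_natural {X Y} f φ := by
    have h := image_of_isPullback (Subobject.isPullback f (Subobject.mk (incl (Subtype.prop φ))))
    have h1 : image (Subobject.mk (incl (Subtype.prop φ))).arrow ≃ₚ φ.1 :=
      ⟨(image_mk_arrow _).1.trans (image_incl _).1, (image_incl _).2.trans (image_mk_arrow _).2⟩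
    constructor
    · refine subobject_le_iff.2 (((image_mk_arrow _).1.trans (image_incl _).1).trans ?_)
      refine le_trans ?_ h.2
      exact reindex_mono f h1.2
    · refine subobject_le_iff.2 (le_trans ?_ ((image_incl _).2.trans (image_mk_arrow _).2))
      exact h.1.trans (reindex_mono f h1.1)

end Strict

/-! ### Transport along isomorphisms of indexed preorders -/

section Congr

variable {A : Type w} {B : Type w'} [Preorder A] [Preorder B]

theorem isLUB_pair_congr {a b j a' b' j' : A} (h : IsLUB {a, b} j) (ha : a ≃ₚ a') (hb : b ≃ₚ b')
    (hj : j ≃ₚ j') : IsLUB {a', b'} j' := by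
  have h := isLUB_pair_iff.1 h
  exact isLUB_pair_iff.2 ⟨ha.2.trans (h.1.trans hj.1), hb.2.trans (h.2.1.trans hj.1),
    fun d h1 h2 => hj.2.trans (h.2.2 d (ha.1.trans h1) (hb.1.trans h2))⟩

theorem isGLB_pair_congr {a b m a' b' m' : A} (h : IsGLB {a, b} m) (ha : a ≃ₚ a') (hb : b ≃ₚ b')
    (hm : m ≃ₚ m') : IsGLB {a', b'} m' := by
  have h := isGLB_pair_iff.1 h
  exact isGLB_pair_iff.2 ⟨hm.2.trans (h.1.trans ha.1), hm.2.trans (h.2.1.trans hb.1),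
    fun d h1 h2 => (h.2.2 d (h1.trans ha.2) (h2.trans hb.2)).trans hm.1⟩

theorem IsLatticeMap.congr {f g : A → B} (hf : IsLatticeMap f) (h : ∀ a, f a ≃ₚ g a) :
    IsLatticeMap g where
  monotone _ _ hab := (h _).2.trans ((hf.monotone hab).trans (h _).1)
  map_top ht c := (hf.map_top ht c).trans (h _).1
  map_bot hb c := (h _).2.trans (hf.map_bot hb c)
  map_meet hm := isGLB_pair_congr (hf.map_meet hm) (h _) (h _) (h _)
  map_join hj := isLUB_pair_congr (hf.map_join hj) (h _) (h _) (h _)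

theorem IsLatticeMap.comp {A' : Type*} [Preorder A'] {f : A → B} {g : B → A'}
    (hg : IsLatticeMap g) (hf : IsLatticeMap f) : IsLatticeMap fun a => g (f a) where
  monotone _ _ hab := hg.monotone (hf.monotone hab)
  map_top ht := hg.map_top (hf.map_top ht)
  map_bot hb := hg.map_bot (hf.map_bot hb)
  map_meet hm := hg.map_meet (hf.map_meet hm)
  map_join hj := hg.map_join (hf.map_join hj)

/-- A map with adjoints on both sides is a homomorphism. -/
theorem IsLatticeMap.of_gc {f : A → B} {l r : B → A} (hl : GaloisConnection l f)
    (hr : GaloisConnection f r) : IsLatticeMap f where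
  monotone := hl.monotone_u
  map_top ht c := (hl _ _).1 (ht _)
  map_bot hb c := (hr _ _).2 (hb _)
  map_meet hm := by
    have hm := isGLB_pair_iff.1 hm
    exact isGLB_pair_iff.2 ⟨hl.monotone_u hm.1, hl.monotone_u hm.2.1,
      fun d h1 h2 => (hl _ _).1 (hm.2.2 _ ((hl _ _).2 h1) ((hl _ _).2 h2))⟩
  map_join hj := by
    have hj := isLUB_pair_iff.1 hj
    exact isLUB_pair_iff.2 ⟨hl.monotone_u hj.1, hl.monotone_u hj.2.1,
      fun d h1 h2 => (hr _ _).2 (hj.2.2 _ ((hr _ _).1 h1) ((hr _ _).1 h2))⟩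

end Congr

namespace IndexedPreorder.Iso

variable {C : Type u} [Category.{v} C] {P : IndexedPreorder.{u, v, w} C}
  {Q : IndexedPreorder.{u, v, w'} C} (e : P.Iso Q)

/-- The inverse isomorphism. -/
def symm : Q.Iso P where
  hom := e.inv
  inv := e.hom
  hom_mono := e.inv_mono
  inv_mono := e.hom_mono
  hom_inv := e.inv_hom
  inv_hom := e.hom_inv
  hom_natural := e.inv_natural
  inv_natural := e.hom_natural

/-- The components are mutually inverse and monotone, hence adjoint on both sides, so they preserve
all lattice structure. -/
theorem gc (X : C) : GaloisConnection (e.hom X) (e.inv X) := fun a b =>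
  ⟨fun h => (e.hom_inv X a).2.trans (e.inv_mono X h),
    fun h => (e.hom_mono X h).trans (e.inv_hom X b).1⟩

theorem gc' (X : C) : GaloisConnection (e.inv X) (e.hom X) := e.symm.gc X

theorem isLatticeMap_hom (X : C) : IsLatticeMap (e.hom X) := .of_gc (e.gc' X) (e.gc X)

theorem isLatticeMap_inv (X : C) : IsLatticeMap (e.inv X) := e.symm.isLatticeMap_hom X

theorem le_of_inv_le {X : C} {a b : Q.Pred X} (h : e.inv X a ≤ e.inv X b) : a ≤ b :=
  ((e.gc' X _ _).1 h).trans (e.inv_hom X b).1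

theorem isLatticeValued (e : P.Iso Q) [P.IsLatticeValued] : Q.IsLatticeValued where
  isDistPrelattice X :=
    { exists_top := ⟨_, (e.isLatticeMap_hom X).map_top (isTop_top _)⟩
      exists_bot :=
        have ⟨_, hb⟩ := IsDistPrelattice.exists_bot (A := P.Pred X)
        ⟨_, (e.isLatticeMap_hom X).map_bot hb⟩
      exists_meet a b := ⟨_, isGLB_pair_congr
        ((e.isLatticeMap_hom X).map_meet (meet_isGLB (e.inv X a) (e.inv X b)))
        (e.inv_hom X a) (e.inv_hom X b) ⟨le_rfl, le_rfl⟩⟩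
      exists_join a b :=
        have ⟨_, hj⟩ := IsDistPrelattice.exists_join (e.inv X a) (e.inv X b)
        ⟨_, isLUB_pair_congr ((e.isLatticeMap_hom X).map_join hj)
          (e.inv_hom X a) (e.inv_hom X b) ⟨le_rfl, le_rfl⟩⟩
      distrib hs hm hp hq :=
        have h := e.isLatticeMap_inv X
        isLUB_pair_congr ((e.isLatticeMap_hom X).map_join (IsDistPrelattice.distrib
          (h.map_join hs) (h.map_meet hm) (h.map_meet hp) (h.map_meet hq)))
          (e.inv_hom X _) (e.inv_hom X _) (e.inv_hom X _) }
  -- By naturality, reindexing in Q is reindexing in P conjugated by the isomorphism.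
  isLatticeMap {X Y} f := ((e.isLatticeMap_hom X).comp
      ((IsLatticeValued.isLatticeMap f).comp (e.isLatticeMap_inv Y))).congr fun a =>
    ⟨(e.hom_mono X (e.inv_natural f a).2).trans (e.inv_hom X _).1,
      (e.inv_hom X _).2.trans (e.hom_mono X (e.inv_natural f a).1)⟩

variable [HasFiniteProducts C]

theorem gc_ex [P.HasLeftAdjoints] (X Y : C) : GaloisConnection
    (fun β : Q.Pred (X ⨯ Y) => e.hom X (P.ex (e.inv _ β))) (Q.map (prod.fst : X ⨯ Y ⟶ X)) :=
  fun _ α => (e.gc X _ _).trans <| (P.ex_gc X Y _ _).trans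
    ⟨fun h => e.le_of_inv_le (h.trans (e.inv_natural _ α).2),
      fun h => (e.inv_mono _ h).trans (e.inv_natural _ α).1⟩

theorem hasLeftAdjoints (e : P.Iso Q) [P.HasLeftAdjoints] : Q.HasLeftAdjoints where
  exists_left_adjoint X Y := ⟨_, e.gc_ex X Y⟩

section Quantifiers

variable [P.HasLeftAdjoints] [Q.HasLeftAdjoints]

/-- Uniqueness of adjoints again: the chosen quantifier of Q agrees with the conjugate of that of P.
This inequality and the next are the two that the transport of Frobenius and Beck–Chevalley needs.
-/
theorem inv_ex_le {X Y : C} (β : Q.Pred (X ⨯ Y)) : e.inv X (Q.ex β) ≤ P.ex (e.inv _ β) :=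
  (e.gc' X _ _).2 ((Q.ex_gc X Y _ _).2 ((e.gc_ex X Y).le_u_l β))

theorem le_ex_of_inv_le {X Y : C} {α : Q.Pred X} {β : Q.Pred (X ⨯ Y)}
    (h : e.inv X α ≤ P.ex (e.inv _ β)) : α ≤ Q.ex β :=
  ((e.gc' X _ _).1 h).trans ((e.gc_ex X Y _ _).2 ((Q.ex_gc X Y).le_u_l β))

theorem frobenius (e : P.Iso Q) [P.IsLatticeValued] [Q.IsLatticeValued] (h : P.Frobenius) :
    Q.Frobenius :=
  frobenius_of_le fun {A B} α β => e.le_ex_of_inv_le <| by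
    have h1 := le_meet_iff.1 (le_refl (α ⩓ Q.ex β))
    refine le_trans (le_meet_iff.2 ⟨e.inv_mono A h1.1,
      (e.inv_mono A h1.2).trans (e.inv_ex_le β)⟩) ((h _ _).2.trans ((P.ex_gc A B).monotone_l ?_))
    have h2 := le_meet_iff.1 (le_refl (P.map (prod.fst : A ⨯ B ⟶ A) (e.inv A α) ⩓ e.inv _ β))
    exact (isGLB_pair_iff.1 ((e.isLatticeMap_inv _).map_meet (meet_isGLB _ _))).2.2 _
      (h2.1.trans (e.inv_natural _ α).2) h2.2

theorem beckChevalley (e : P.Iso Q) (h : P.BeckChevalley) : Q.BeckChevalley :=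
  beckChevalley_of_le fun {B _ Y _} f g sq a => e.le_ex_of_inv_le <|
    (e.inv_natural g _).1.trans <| (P.map_mono g (e.inv_ex_le a)).trans <|
      (h f g sq _).2.trans ((P.ex_gc B Y).monotone_l (e.inv_natural f a).2)

end Quantifiers

section Equality

variable [P.IsLatticeValued] [Q.IsLatticeValued]

theorem isEq_hom {X : C} {E : P.Pred (X ⨯ X)} (h : P.IsEq X E) : Q.IsEq X (e.hom _ E) := by
  intro A
  have h1 : e.inv X (top (Q.Pred X)) ≃ₚ top (P.Pred X) :=
    ⟨isTop_top _ _, (e.isLatticeMap_inv X).map_top (isTop_top _) _⟩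
  rw [e.gc, ← h]
  exact ⟨fun h2 => h1.2.trans ((e.inv_mono X h2).trans (e.inv_natural _ A).1),
    fun h2 => e.le_of_inv_le (h1.1.trans (h2.trans (e.inv_natural _ A).2))⟩

theorem hasEquality (e : P.Iso Q) (h : P.HasEquality) : Q.HasEquality where
  exists_eq X :=
    have ⟨_, hE⟩ := h.exists_eq X
    ⟨_, e.isEq_hom hE⟩
  eq_prod {A B EA EB EAB} hA hB hAB := by
    -- The three predicates are arbitrary equality predicates of Q; their inverse images are
    -- equality predicates of P, where the product formula is known.
    have h1 := h.eq_prod (e.symm.isEq_hom hA) (e.symm.isEq_hom hB) (e.symm.isEq_hom hAB)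
    have h2 := isGLB_pair_congr (meet_isGLB (P.map (prod.lift (prod.fst ≫ prod.fst)
        (prod.snd ≫ prod.fst)) (e.inv _ EA)) (P.map (prod.lift (prod.fst ≫ prod.snd)
        (prod.snd ≫ prod.snd)) (e.inv _ EB))) (e.symm.hom_natural _ EA).symm
      (e.symm.hom_natural _ EB).symm h1
    have h3 := isGLB_pair_iff.1 h2
    have h4 := isGLB_pair_iff.1 ((e.isLatticeMap_inv _).map_meet (meet_isGLB
      (Q.map (prod.lift (prod.fst ≫ prod.fst) (prod.snd ≫ prod.fst)) EA)
      (Q.map (prod.lift (prod.fst ≫ prod.snd) (prod.snd ≫ prod.snd)) EB)))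
    exact ⟨e.le_of_inv_le (h3.2.2 _ h4.1 h4.2.1), e.le_of_inv_le (h4.2.2 _ h3.1 h3.2.1)⟩

end Equality

end IndexedPreorder.Iso

/-! ### Equality predicates for subobjects -/

section SubobjectEquality

variable {D : Type u} [Category.{v} D] [HasFiniteLimits D]

theorem le_iff_factors {X : D} {S T : Subobject X} : S ≤ T ↔ T.Factors S.arrow :=
  ⟨fun h => Subobject.factors_of_le _ h (Subobject.factors_self S),
    fun h => Subobject.le_of_comm (T.factorThru _ h) (T.factorThru_arrow _ h)⟩

/-- Turns inequalities with reindexed subobjects into factorizations, and for the diagonal into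
equations between morphisms. -/
theorem le_pullback_iff_factors {X Y : D} (f : X ⟶ Y) {S : Subobject X} {T : Subobject Y} :
    S ≤ (Subobject.pullback f).obj T ↔ T.Factors (S.arrow ≫ f) := by
  have sq := Subobject.isPullback f T
  constructor
  · intro h
    rw [← Subobject.ofLE_arrow h, Category.assoc, ← sq.w, ← Category.assoc]
    exact Subobject.factors_comp_arrow _
  · intro h
    exact Subobject.le_of_comm (sq.lift (T.factorThru _ h) S.arrow (T.factorThru_arrow _ h))
      (sq.lift_snd _ _ _)

theorem mk_diag_factors_iff {W X : D} {f : W ⟶ X ⨯ X} :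
    (Subobject.mk (prod.lift (𝟙 X) (𝟙 X))).Factors f ↔ f ≫ prod.fst = f ≫ prod.snd := by
  rw [Subobject.mk_factors_iff]
  constructor
  · rintro ⟨g, rfl⟩
    have h (k : W ⟶ X) :
        (k ≫ prod.lift (𝟙 X) (𝟙 X)) ≫ prod.fst = (k ≫ prod.lift (𝟙 X) (𝟙 X)) ≫ prod.snd := by
      simp
    exact h g
  · intro h
    exact ⟨f ≫ prod.fst, by ext <;> simp [h]⟩

variable [(subobjects D).IsLatticeValued]

theorem isEq_mk_diag (X : D) :
    (subobjects D).IsEq X (Subobject.mk (prod.lift (𝟙 X) (𝟙 X))) := by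
  intro (A : Subobject (X ⨯ X))
  -- The chosen top of the prelattice has to be matched with the order-theoretic `⊤` of `Subobject
  -- X`.
  have h : top ((subobjects D).Pred X) ≃ₚ (⊤ : Subobject X) :=
    ⟨le_top (α := Subobject X), isTop_top _ _⟩
  trans (⊤ : Subobject X) ≤ (Subobject.pullback (prod.lift (𝟙 X) (𝟙 X))).obj A
  · exact ⟨fun h' => h.2.trans h', fun h' => h.1.trans h'⟩
  rw [le_pullback_iff_factors]
  constructor
  · intro h'
    -- The arrow of `⊤` is invertible, so it can be cancelled.
    have h' := Subobject.factors_of_factors_right (inv (⊤ : Subobject X).arrow) h'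
    rw [IsIso.inv_hom_id_assoc] at h'
    exact Subobject.mk_le_of_comm (A.factorThru _ h') (A.factorThru_arrow _ h')
  · intro h'
    refine Subobject.factors_of_factors_right _ (Subobject.factors_of_le _ h' ?_)
    exact mk_diag_factors_iff.2 (by simp)

/-- Equality predicates represent the same condition, so by antisymmetry of subobjects each of them
is the diagonal. -/
theorem factors_iff_of_isEq {W X : D} {E : Subobject (X ⨯ X)} (hE : (subobjects D).IsEq X E)
    {f : W ⟶ X ⨯ X} : E.Factors f ↔ f ≫ prod.fst = f ≫ prod.snd := by
  have h := isEq_mk_diag X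
  have : E = Subobject.mk (prod.lift (𝟙 X) (𝟙 X)) :=
    le_antisymm ((hE _).1 ((h _).2 le_rfl)) ((h E).1 ((hE E).2 le_rfl))
  rw [this, mk_diag_factors_iff]

/-- Through factorizations, the product formula says that two morphisms into A × B agree exactly
when both components agree. -/
theorem hasEquality_subobjects : (subobjects D).HasEquality where
  exists_eq X := ⟨_, isEq_mk_diag X⟩
  eq_prod {A B EA EB EAB} hA hB hAB := by
    have hm := le_meet_iff.1 (le_refl ((subobjects D).map
      (prod.lift (prod.fst ≫ prod.fst) (prod.snd ≫ prod.fst)) EA ⩓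
      (subobjects D).map (prod.lift (prod.fst ≫ prod.snd) (prod.snd ≫ prod.snd)) EB))
    constructor
    · have h1 := (factors_iff_of_isEq hA).1 ((le_pullback_iff_factors _).1 hm.1)
      have h2 := (factors_iff_of_isEq hB).1 ((le_pullback_iff_factors _).1 hm.2)
      refine le_iff_factors.2 ((factors_iff_of_isEq hAB).2 ?_)
      ext
      · simpa using h1
      · simpa using h2
    · have h := (factors_iff_of_isEq hAB).1 (Subobject.factors_self EAB)
      refine le_meet_iff.2 ⟨(le_pullback_iff_factors _).2 ((factors_iff_of_isEq hA).2 ?_),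
        (le_pullback_iff_factors _).2 ((factors_iff_of_isEq hB).2 ?_)⟩
      · simp [reassoc_of% h]
      · simp [reassoc_of% h]

end SubobjectEquality

/-! ### Regularity -/

section Regular

variable {C : Type u} [Category.{v} C] [HasFiniteProducts C]
  {P : IndexedPreorder.{u, v, w} C} [P.IsCoherent] {W X Y Z : PER P}

/-- A morphism whose image is everything. -/
def Surjective (f : X ⟶ Y) : Prop := P.app Y.rel (𝟙 _) (𝟙 _) ≤ image f

theorem Surjective.elim {f : X ⟶ Y} (hf : Surjective f) {Γ : C} {δ ψ : P.Pred Γ}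
    {y : Γ ⟶ Y.carrier} (h : δ ≤ P.app Y.rel y y)
    (h' : ∀ (Δ : C) (σ : Δ ⟶ Γ) (x : Δ ⟶ X.carrier) (δ' : P.Pred Δ), δ' ≤ P.map σ δ →
      δ' ≤ P.app (graph f) x (σ ≫ y) → δ' ≤ P.map σ ψ) : δ ≤ ψ :=
  image_elim (le_trans (by rwa [P.le_map_app_iff, Category.comp_id]) (P.map_mono y hf)) h'

theorem Surjective.of_elim {f : X ⟶ Y} (h : ∀ {Γ : C} {δ : P.Pred Γ} {y : Γ ⟶ Y.carrier},
    δ ≤ P.app Y.rel y y → δ ≤ P.map y (image f)) : Surjective f :=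
  (h le_rfl).trans (P.map_id _).1

theorem Surjective.epi {f : X ⟶ Y} (hf : Surjective f) : Epi f where
  left_cancellation g h e := hom_ext_app fun {Γ δ y z} h1 =>
    hf.elim ((isFunctional_graph g).strict_left h1) fun Δ σ x δ' hδ h2 => by
      rw [P.le_map_app_iff]
      refine graph_comp_cancel (f := f) ?_ h2
      rw [← e]
      exact graph_comp_intro h2 (P.app_tr hδ h1)

/-- A morphism that identifies the kernel pair of a surjective `f` factors through `f`. -/
theorem Surjective.exists_desc {f : X ⟶ Y} (hf : Surjective f) {p q : W ⟶ X}
    (hk : IsKernelPair f p q) (k : X ⟶ Z) (h : p ≫ k = q ≫ k) : ∃ l, f ≫ l = k := by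
  have hF := isFunctional_graph f
  have hK := isFunctional_graph k
  -- Elements with the same f-value come from an element of the kernel pair, where both projections
  -- have the same k-value.
  have key {Γ : C} {δ : P.Pred Γ} {x x' : Γ ⟶ X.carrier} {y : Γ ⟶ Y.carrier}
      {z : Γ ⟶ Z.carrier} (h1 : δ ≤ P.app (graph f) x y) (h2 : δ ≤ P.app (graph f) x' y)
      (h3 : δ ≤ P.app (graph k) x z) : δ ≤ P.app (graph k) x' z :=
    isPullback_elim hk h1 h2 fun Δ σ w δ' hδ h4 h5 => by
      rw [P.le_map_app_iff]
      refine graph_comp_cancel (f := q) ?_ h5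
      rw [← h]
      exact graph_comp_intro h4 (P.app_tr hδ h3)
  -- The factor sends y to the k-value of any x over y; `key` makes it well defined and surjectivity
  -- of f makes it total.
  have hL : IsFunctional Y Z (compRel (conv (graph f)) (graph k)) := .of_app
    (fun h => ⟨compRel_elim h fun Δ σ x δ' _ h1 _ => by
        rw [P.le_map_app_iff]
        exact hF.strict_right (le_app_conv_iff.1 h1),
      compRel_elim h fun Δ σ x δ' _ _ h2 => by
        rw [P.le_map_app_iff]
        exact hK.strict_right h2⟩)
    (fun h hy hz => compRel_elim h fun Δ σ x δ' hδ h1 h2 => by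
      rw [P.le_map_app_iff]
      have h1 := le_app_conv_iff.1 h1
      exact compRel_intro x
        (le_app_conv_iff.2 (hF.relational_app h1 (hF.strict_left h1) (P.app_tr hδ hy)))
        (hK.relational_app h2 (hK.strict_left h2) (P.app_tr hδ hz)))
    (fun h h' => compRel_elim h fun Δ σ x δ' hδ h1 h2 => compRel_elim (P.app_tr hδ h')
      fun Δ' τ x' δ'' hδ' h3 h4 => by
        rw [← P.le_map_comp_iff, P.le_map_app_iff]
        have h5 := key (P.app_tr hδ' (le_app_conv_iff.1 h1)) (le_app_conv_iff.1 h3)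
          (P.app_tr hδ' h2)
        simpa using hK.singleValued_app h5 h4)
    (fun {_ _ y} hy => hf.elim hy fun Δ σ x δ' hδ h1 => hK.total_elim (hF.strict_left h1)
      fun Δ' τ z δ'' hδ' h2 => by
        rw [← P.le_map_comp_iff, ← P.le_map_comp_iff]
        exact P.ex_intro z (compRel_intro (τ ≫ x)
          (le_app_conv_iff.2 (by simpa using P.app_tr hδ' h1)) h2))
  refine ⟨ofRel _ hL, hom_ext_app fun h => graph_comp_elim h fun Δ σ y δ' hδ h1 h2 =>
    compRel_elim (le_graph_ofRel_iff.1 h2) fun Δ' τ x δ'' hδ' h3 h4 => ?_⟩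
  rw [← P.le_map_comp_iff, P.le_map_app_iff]
  simpa using key (le_app_conv_iff.1 h3) (P.app_tr hδ' h1) h4

/-- A surjective morphism is the coequalizer of its kernel pair. -/
noncomputable def Surjective.isColimit {f : X ⟶ Y} (hf : Surjective f) {p q : W ⟶ X}
    (hk : IsKernelPair f p q) : IsColimit (Cofork.ofπ f hk.w) :=
  have := hf.epi
  Cofork.IsColimit.mk' _ fun s =>
    ⟨(hf.exists_desc hk s.π s.condition).choose, (hf.exists_desc hk s.π s.condition).choose_spec,
      fun hm => (cancel_epi f).1
        (hm.trans (hf.exists_desc hk s.π s.condition).choose_spec.symm)⟩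

/-- Every morphism is a surjection followed by the inclusion of its image. -/
theorem exists_surjective_comp_incl (f : X ⟶ Y) :
    ∃ g : X ⟶ restrict (isStrictRel_image f), Surjective g ∧ g ≫ incl (isStrictRel_image f) = f := by
  obtain ⟨g, hg⟩ := exists_lift_incl (isStrictRel_image f) f le_rfl
  refine ⟨g, .of_elim fun h => ?_, hg⟩
  refine image_elim (f := f) (le_restrictRel_iff.1 h).2 fun Δ σ x δ' _ h1 => ?_
  rw [← P.le_map_comp_iff]
  rw [← hg] at h1
  exact image_intro ((comp_incl_iff g).1 h1)

/-- For y with g-value z, choose x over z; the pair (x, y) comes from an element of W over y. -/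
theorem Surjective.of_isPullback {p : W ⟶ X} {q : W ⟶ Y} {f : X ⟶ Z} {g : Y ⟶ Z}
    (sq : IsPullback p q f g) (hf : Surjective f) : Surjective q :=
  .of_elim fun {Γ δ y} h => (isFunctional_graph g).total_elim h fun Δ σ z δ' _ h1 =>
    hf.elim ((isFunctional_graph g).strict_right h1) fun Δ' τ x δ'' hδ h2 =>
      isPullback_elim sq h2 (P.app_tr hδ h1) fun Δ'' ρ w δ₃ _ _ h3 => by
        rw [← P.le_map_comp_iff, ← P.le_map_comp_iff, ← P.le_map_comp_iff]
        exact image_intro (by simpa using h3)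

/-- A regular epi is strong, so the inclusion of its image is both mono and strong epi, hence
invertible: the image is everything. -/
theorem Surjective.of_isRegularEpi (f : X ⟶ Y) [IsRegularEpi f] : Surjective f := by
  obtain ⟨g, -, hg⟩ := exists_surjective_comp_incl f
  have : StrongEpi (g ≫ incl (isStrictRel_image f)) := by rw [hg]; infer_instance
  have := strongEpi_of_strongEpi g (incl (isStrictRel_image f))
  have := isIso_of_mono_of_strongEpi (incl (isStrictRel_image f))
  refine .of_elim fun {Γ δ y} h => ?_
  refine graph_comp_elim (f := inv (incl (isStrictRel_image f))) (g := incl (isStrictRel_image f))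
    (x := y) (z := y) (by rwa [IsIso.inv_hom_id, le_graph_id_iff]) fun Δ σ x δ' _ _ h1 => ?_
  rw [← P.le_map_comp_iff]
  exact (image_intro h1).trans (P.map_mono _ (image_incl _).1)

variable [HasFiniteLimits (PER P)]

theorem Surjective.isRegularEpi {f : X ⟶ Y} (hf : Surjective f) : IsRegularEpi f :=
  ⟨⟨_, _, _, _, hf.isColimit (IsKernelPair.of_hasPullback f)⟩⟩

theorem regular_PER : Regular (PER P) where
  hasCoequalizer_of_isKernelPair {X Y Z f p q} hk := by
    -- The coequalizer is the surjective part g of f. As the inclusion is mono, f and g have the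
    -- same kernel pairs.
    obtain ⟨g, hg, e⟩ := exists_surjective_comp_incl f
    have hk' : IsKernelPair g p q := by
      rw [← e] at hk
      exact hk.cancel_right_of_mono
    exact ⟨⟨_, hg.isColimit hk'⟩⟩
  regularEpiIsStableUnderBaseChange :=
    ⟨fun {_ _ _ _ _ g _ _} sq (_ : IsRegularEpi g) =>
      (Surjective.of_isPullback sq (.of_isRegularEpi _)).isRegularEpi⟩

theorem coherentCategory_PER [(subobjects (PER P)).IsLatticeValued] :
    CoherentCategory (PER P) where
  toRegular := regular_PER
  exists_bot X := IsDistPrelattice.exists_bot (A := (subobjects (PER P)).Pred X)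
  exists_union S T := IsDistPrelattice.exists_join (A := (subobjects (PER P)).Pred _) S T
  pullback_bot f _ h := (IsLatticeValued.isLatticeMap (P := subobjects (PER P)) f).map_bot h
  pullback_union f _ _ _ h :=
    (IsLatticeValued.isLatticeMap (P := subobjects (PER P)) f).map_join h

end Regular

end Hyperdoctrine

/-! ### Assembly of the four claims -/

theorem mainTheorem4 {C : Type u} [Category.{v} C] [HasFiniteProducts C]
    (P : Hyperdoctrine.IndexedPreorder.{u, v, w} C) [P.IsCoherent] :
    ∃ _ : HasFiniteLimits (Hyperdoctrine.PER P),
      (Hyperdoctrine.strictRelations P).IsCoherent ∧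
      (Hyperdoctrine.subobjects (Hyperdoctrine.PER P)).IsCoherent ∧
      Nonempty ((Hyperdoctrine.subobjects (Hyperdoctrine.PER P)).Iso
        (Hyperdoctrine.strictRelations P)) ∧
      Hyperdoctrine.CoherentCategory (Hyperdoctrine.PER P) := by
  have hlim := Hyperdoctrine.hasFiniteLimits_PER (P := P)
  let e := Hyperdoctrine.subobjectsIso (P := P)
  have hsub := e.symm.isLatticeValued
  have hex := e.symm.hasLeftAdjoints
  -- Equality is the one structure that travels from Sub to Strict; the rest travels the other way.
  have heq : (Hyperdoctrine.subobjects (Hyperdoctrine.PER P)).HasEquality :=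
    Hyperdoctrine.hasEquality_subobjects
  exact ⟨hlim,
    { hasEquality := e.hasEquality heq
      frobenius := Hyperdoctrine.frobenius_strictRelations
      beckChevalley := Hyperdoctrine.beckChevalley_strictRelations },
    { hasEquality := heq
      frobenius := e.symm.frobenius Hyperdoctrine.frobenius_strictRelations
      beckChevalley := e.symm.beckChevalley Hyperdoctrine.beckChevalley_strictRelations },
    ⟨e⟩, Hyperdoctrine.coherentCategory_PER⟩
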